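/- Let $G$ be a compact Lie group with normalised Haar measure $\mu$, let $\widehat G$ be the set of unitary equivalence classes of continuous irreducible unitary representations of $G$, and choose for each class $[\xi]\in\widehat G$ a representative written, in an orthonormal basis, as a matrix-valued function $\xi:G\to\mathbb C^{d_\xi\times d_\xi}$. Let $0<r\le 1$, $1\le p<\infty$ and $\widetilde p=\min\{2,p\}$. Let $A:L^p(G)\to L^p(G)$ be a continuous linear operator, with matrix-valued symbol $$\sigma_A(x,\xi)=\xi(x)^*(A\xi)(x)\in\mathbb C^{d_\xi\times d_\xi},\qquad (A\xi)_{ij}=A(\xi_{ij}).$$ For $B\in\mathbb C^{d\times d}$ put $\|B\|_{op(\ell^\infty,\ell^\infty)}=\max_{1\le i\le d}\sum_{j=1}^d|B_{ij}|$, and let $B^t$ be the transpose of $B$. Suppose that $$\sum_{[\xi]\in\widehat G}d_\xi^{\,2+\frac r{\widetilde p}}\left(\int_G\|\sigma_A(x,\xi)^t\|_{op(\ell^\infty,\ell^\infty)}^p\,d\mu(x)\right)^{r/p}<\infty.$$ Then $A$ is $r$-nuclear on $L^p(G)$, that is, there are sequences $(x_n')$ in $L^p(G)'$ and $(y_n)$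 in $L^p(G)$ with $\sum_n\|x_n'\|^r\|y_n\|^r<\infty$ and $Af=\sum_n\langle f,x_n'\rangle y_n$ for all $f\in L^p(G)$. Moreover, the series $\sum_{[\xi]}d_\xi\operatorname{Tr}(\sigma_A(x,\xi))$ converges absolutely for almost every $x\in G$, its sum is integrable, and the nuclear trace of $A$ is $$\operatorname{Tr}A=\int_G\sum_{[\xi]\in\widehat G}d_\xi\operatorname{Tr}(\sigma_A(x,\xi))\,d\mu(x).$$ Here $\operatorname{Tr}A=\sum_n x_n'(y_n)$, which takes the same value for every representation $Af=\sum_n\langle f,x_n'\rangle y_n$ with $\sum_n\|x_n'\|\|y_n\|<\infty$. -/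

import Mathlib

open MeasureTheory
open scoped ENNReal Manifold ContDiff Matrix

noncomputable section

/-! ### `r`-nuclear operators and the nuclear trace -/

section Nuclear

variable {E F : Type*} [NormedAddCommGroup E] [NormedSpace ℂ E]
  [NormedAddCommGroup F] [NormedSpace ℂ F]

/-- The sequences `x' n ∈ E'` and `y n ∈ F` form an `r`-nuclear representation of `T`:
`T x = ∑ₙ ⟨x, x' n⟩ y n` for every `x`, and `∑ₙ ‖x' n‖ ^ r * ‖y n‖ ^ r < ∞`. -/
def IsNuclearRepresentation (r : ℝ) (T : E →L[ℂ] F) (x' : ℕ → (E →L[ℂ] ℂ)) (y : ℕ → F) : Prop :=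
  (∀ x : E, HasSum (fun n => x' n x • y n) (T x)) ∧
    Summable (fun n => ‖x' n‖ ^ r * ‖y n‖ ^ r)

/-- `T` is `r`-nuclear. -/
def IsRNuclear (r : ℝ) (T : E →L[ℂ] F) : Prop :=
  ∃ (x' : ℕ → (E →L[ℂ] ℂ)) (y : ℕ → F), IsNuclearRepresentation r T x' y

/-- `T` is nuclear (the case `r = 1`) and its trace is well defined and equal to `t`: for every
nuclear representation of `T`, the series `∑ₙ x' n (y n)` converges with sum `t`. -/
def HasNuclearTrace (T : E →L[ℂ] E) (t : ℂ) : Prop :=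
  IsRNuclear 1 T ∧
    ∀ (x' : ℕ → (E →L[ℂ] ℂ)) (y : ℕ → E), IsNuclearRepresentation 1 T x' y →
      HasSum (fun n => x' n (y n)) t

end Nuclear

/-! ### The unitary dual -/

/-- The action on column vectors `ℂᵈ` of a matrix representation. -/
def matrixRepresentation {G : Type*} [Group G] {d : ℕ}
    (φ : G →* Matrix.unitaryGroup (Fin d) ℂ) : Representation ℂ G (Fin d → ℂ) :=
  ((Matrix.toLinAlgEquiv' : Matrix (Fin d) (Fin d) ℂ ≃ₐ[ℂ] _) :
      Matrix (Fin d) (Fin d) ℂ →* ((Fin d → ℂ) →ₗ[ℂ] (Fin d → ℂ))).comp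
    ((Matrix.unitaryGroup (Fin d) ℂ).subtype.comp φ)

/-- A continuous irreducible unitary representation of `G`, written as a matrix-valued function
with respect to an orthonormal basis of the representation space. (For a compact group every
continuous irreducible unitary representation is finite-dimensional.) -/
structure UnitaryIrrep (G : Type*) [Group G] [TopologicalSpace G] where
  /-- The dimension of the representation space. -/
  dim : ℕ
  /-- The underlying homomorphism into the unitary group. -/
  toHom : G →* Matrix.unitaryGroup (Fin dim) ℂ
  continuous_mat : Continuous fun x : G => (toHom x : Matrix (Fin dim) (Fin dim) ℂ)
  irreducible_rep : (matrixRepresentation toHom).IsIrreducible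

namespace UnitaryIrrep

variable {G : Type*} [Group G] [TopologicalSpace G]

/-- The matrix `ξ(x)`. -/
def mat (ξ : UnitaryIrrep G) (x : G) : Matrix (Fin ξ.dim) (Fin ξ.dim) ℂ := ξ.toHom x

/-- The matrix coefficient `ξ_{ij}` as a continuous function on `G`. -/
def coeff (ξ : UnitaryIrrep G) (i j : Fin ξ.dim) : C(G, ℂ) where
  toFun x := ξ.mat x i j
  continuous_toFun := ξ.continuous_mat.matrix_elem i j

/-- Unitary equivalence: there is a unitary intertwining matrix. -/
def Equivalent (ξ η : UnitaryIrrep G) : Prop :=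
  ∃ U : Matrix (Fin η.dim) (Fin ξ.dim) ℂ,
    Uᴴ * U = 1 ∧ U * Uᴴ = 1 ∧ ∀ x : G, U * ξ.mat x = η.mat x * U

instance instSetoid (G : Type*) [Group G] [TopologicalSpace G] : Setoid (UnitaryIrrep G) where
  r := Equivalent
  iseqv :=
    { refl := fun ξ => ⟨1, by simp, by simp, by simp⟩
      symm := by
        rintro ξ η ⟨U, h1, h2, h3⟩
        refine ⟨Uᴴ, by simpa using h2, by simpa using h1, fun x => ?_⟩
        calc Uᴴ * η.mat x = Uᴴ * (η.mat x * U) * Uᴴ := by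
              rw [Matrix.mul_assoc, Matrix.mul_assoc, h2, Matrix.mul_one]
          _ = ξ.mat x * Uᴴ := by
              rw [← h3, ← Matrix.mul_assoc, h1, Matrix.one_mul]
      trans := by
        rintro ξ η ζ ⟨U, h1, h2, h3⟩ ⟨V, k1, k2, k3⟩
        refine ⟨V * U, ?_, ?_, fun x => ?_⟩
        · rw [Matrix.conjTranspose_mul, Matrix.mul_assoc, ← Matrix.mul_assoc Vᴴ, k1,
            Matrix.one_mul, h1]
        · rw [Matrix.conjTranspose_mul, Matrix.mul_assoc, ← Matrix.mul_assoc U, h2,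
            Matrix.one_mul, k2]
        · rw [Matrix.mul_assoc, h3, ← Matrix.mul_assoc, k3, Matrix.mul_assoc] }

end UnitaryIrrep

/-- The unitary dual `Ĝ`: equivalence classes of continuous irreducible unitary
representations. -/
def UnitaryDual (G : Type*) [Group G] [TopologicalSpace G] : Type _ :=
  Quotient (UnitaryIrrep.instSetoid G)

/-- The class `[ξ]` of a representation `ξ`. -/
def UnitaryIrrep.cls {G : Type*} [Group G] [TopologicalSpace G] (ξ : UnitaryIrrep G) :
    UnitaryDual G :=
  Quotient.mk (UnitaryIrrep.instSetoid G) ξ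

/-! ### The matrix-valued symbol -/

/-- The operator norm on `ℂᵈ` with the `ℓ^∞` norm, `max_i ∑_j |B_{ij}|`. -/
def opNormLinfty {d : ℕ} (B : Matrix (Fin d) (Fin d) ℂ) : ℝ :=
  ⨆ i, ∑ j, ‖B i j‖

section Symbol

variable {G : Type*} [Group G] [TopologicalSpace G] [CompactSpace G] [MeasurableSpace G]
  [BorelSpace G] {μ : Measure G} [IsFiniteMeasure μ] {p : ℝ≥0∞} [Fact (1 ≤ p)]

/-- The matrix-valued symbol `σ_A(x, ξ) = ξ(x)^* (Aξ)(x)`, where `(Aξ)_{ij} = A(ξ_{ij})`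
(determined for almost every `x`). -/
def matrixSymbol (A : Lp ℂ p μ →L[ℂ] Lp ℂ p μ) (ξ : UnitaryIrrep G) (x : G) :
    Matrix (Fin ξ.dim) (Fin ξ.dim) ℂ :=
  (ξ.mat x)ᴴ * Matrix.of fun i j => (A (ContinuousMap.toLp p μ ℂ (ξ.coeff i j)) : G → ℂ) x

end Symbol

end

/-!
Schur orthogonality and the Peter–Weyl theorem give the Fourier inversion
`A f = ∑ d_ξ (∫ f conj ξ_{ij}) A ξ_{ij}`, first on the dense span of the matrix coefficients and
then on `L^p(G)` by absolute convergence. Since `|ξ_{ij}| ≤ 1` and `∫ |ξ_{ij}|² = 1 / d_ξ`, Hölder's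
inequality bounds the norm of `f ↦ d_ξ ∫ f conj ξ_{ij}` by `d_ξ ^ (1 / p̃)`, while `A ξ = ξ σ_A`
bounds `‖A ξ_{ij}‖` by the `L^p` norm of `‖σ_A(·, ξ)ᵗ‖`. There are `d_ξ²` pairs `(i, j)`, hence the
exponent `2 + r / p̃`. For this nuclear representation the trace is
`∑ d_ξ ∫ conj ξ_{ij} A ξ_{ij}`, the integral of `∑ d_ξ Tr σ_A`. Another representation gives the
same value because `L^p` has the bounded approximation property, witnessed by the conditional
expectations onto finite `σ`-algebras.
-/

noncomputable section

section NuclearTrace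

open Filter Topology

/-- The bounded approximation property: the identity is the strong limit of a net of uniformly
bounded operators of finite rank. It makes the trace of a nuclear operator independent of the
nuclear representation. The net is encoded as a filter on the space of operators. -/
def HasBoundedApproximationProperty (E : Type*) [NormedAddCommGroup E] [NormedSpace ℂ E] : Prop :=
  ∃ (C : ℝ) (l : Filter (E →L[ℂ] E)), l.NeBot ∧ (∀ᶠ R in l, ‖R‖ ≤ C) ∧
    (∀ᶠ R in l, FiniteDimensional ℂ R.range) ∧ ∀ y, Tendsto (fun R => R y) l (𝓝 y)

variable {E F : Type*} [NormedAddCommGroup E] [NormedSpace ℂ E]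
  [NormedAddCommGroup F] [NormedSpace ℂ F]

theorem exists_eq_sum_smul_of_finiteDimensional_range (R : E →L[ℂ] F)
    [FiniteDimensional ℂ R.range] :
    ∃ (m : ℕ) (φ : Fin m → E →L[ℂ] ℂ) (z : Fin m → F), ∀ x, R x = ∑ j, φ j x • z j := by
  let b := Module.finBasis ℂ R.range
  refine ⟨_, fun j => (b.coord j).toContinuousLinearMap.comp R.rangeRestrict,
    fun j => (b j : F), fun x => ?_⟩
  exact (congrArg Subtype.val (b.sum_repr (R.rangeRestrict x))).symm.trans (Submodule.coe_sum ..)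

theorem summable_of_summable_rpow {ι : Type*} {a : ι → ℝ} (ha : ∀ i, 0 ≤ a i) {r : ℝ}
    (hr0 : 0 < r) (hr1 : r ≤ 1) (h : Summable fun i => a i ^ r) : Summable a := by
  have hr : (ENNReal.ofReal r).toReal = r := ENNReal.toReal_ofReal hr0.le
  have hmem : Memℓp a (ENNReal.ofReal r) :=
    memℓp_gen (by simpa only [hr, Real.norm_of_nonneg (ha _)] using h)
  exact (hmem.of_exponent_ge (ENNReal.ofReal_le_one.2 hr1)).summable_of_one

namespace IsNuclearRepresentation

theorem summable_norm {T : E →L[ℂ] F} {x' : ℕ → E →L[ℂ] ℂ} {y : ℕ → F}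
    (h : IsNuclearRepresentation 1 T x' y) : Summable fun n => ‖x' n‖ * ‖y n‖ := by
  simpa only [Real.rpow_one] using h.2

theorem one_of_le_one {r : ℝ} (hr0 : 0 < r) (hr1 : r ≤ 1) {T : E →L[ℂ] F}
    {x' : ℕ → E →L[ℂ] ℂ} {y : ℕ → F} (h : IsNuclearRepresentation r T x' y) :
    IsNuclearRepresentation 1 T x' y := by
  refine ⟨h.1, ?_⟩
  simpa only [Real.rpow_one] using summable_of_summable_rpow (fun n => by positivity) hr0 hr1
    (by simpa only [Real.mul_rpow (norm_nonneg _) (norm_nonneg _)] using h.2)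

theorem summable_apply {T : E →L[ℂ] E} {x' : ℕ → E →L[ℂ] ℂ} {y : ℕ → E}
    (h : IsNuclearRepresentation 1 T x' y) : Summable fun n => x' n (y n) :=
  h.summable_norm.of_norm_bounded fun n => (x' n).le_opNorm _

theorem hasSum_apply_sum_smul {T : E →L[ℂ] E} {x' : ℕ → E →L[ℂ] ℂ} {y : ℕ → E}
    (h : IsNuclearRepresentation 1 T x' y) {ι : Type*} [Fintype ι] (φ : ι → E →L[ℂ] ℂ)
    (z : ι → E) :
    HasSum (fun n => x' n (∑ j, φ j (y n) • z j)) (∑ j, φ j (T (z j))) := by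
  have hφ (j : ι) : HasSum (fun n => φ j (x' n (z j) • y n)) (φ j (T (z j))) :=
    (h.1 (z j)).mapL (φ j)
  convert hasSum_sum (s := Finset.univ) fun j _ => hφ j using 2
  simp only [map_sum, map_smul, smul_eq_mul, mul_comm]

theorem tendsto_tsum_apply {T : E →L[ℂ] E} {x' : ℕ → E →L[ℂ] ℂ} {y : ℕ → E}
    (h : IsNuclearRepresentation 1 T x' y) {C : ℝ} {l : Filter (E →L[ℂ] E)}
    (hC : ∀ᶠ R in l, ‖R‖ ≤ C) (hl : ∀ y, Tendsto (fun R => R y) l (𝓝 y)) :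
    Tendsto (fun R => ∑' n, x' n (R (y n))) l (𝓝 (∑' n, x' n (y n))) := by
  refine tendsto_tsum_of_dominated_convergence (h.summable_norm.mul_left C)
    (fun n => ((x' n).continuous.tendsto _).comp (hl (y n))) ?_
  filter_upwards [hC] with R hR n
  calc ‖x' n (R (y n))‖ ≤ ‖x' n‖ * (C * ‖y n‖) := (x' n).le_opNorm_of_le (R.le_of_opNorm_le hR _)
    _ = C * (‖x' n‖ * ‖y n‖) := by ring

theorem tsum_apply_eq (hE : HasBoundedApproximationProperty E) {T : E →L[ℂ] E}
    {x₁ x₂ : ℕ → E →L[ℂ] ℂ} {y₁ y₂ : ℕ → E} (h₁ : IsNuclearRepresentation 1 T x₁ y₁)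
    (h₂ : IsNuclearRepresentation 1 T x₂ y₂) :
    ∑' n, x₁ n (y₁ n) = ∑' n, x₂ n (y₂ n) := by
  obtain ⟨C, l, _, hC, hfin, hl⟩ := hE
  refine tendsto_nhds_unique (h₁.tendsto_tsum_apply hC hl)
    ((h₂.tendsto_tsum_apply hC hl).congr' ?_)
  filter_upwards [hfin] with R _
  obtain ⟨m, φ, z, hR⟩ := exists_eq_sum_smul_of_finiteDimensional_range R
  simp only [hR, (h₁.hasSum_apply_sum_smul φ z).tsum_eq, (h₂.hasSum_apply_sum_smul φ z).tsum_eq]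

theorem hasNuclearTrace (hE : HasBoundedApproximationProperty E) {T : E →L[ℂ] E}
    {x' : ℕ → E →L[ℂ] ℂ} {y : ℕ → E} (h : IsNuclearRepresentation 1 T x' y) :
    HasNuclearTrace T (∑' n, x' n (y n)) :=
  ⟨⟨x', y, h⟩, fun _ _ h₂ => h.tsum_apply_eq hE h₂ ▸ h₂.summable_apply.hasSum⟩

end IsNuclearRepresentation

theorem exists_isNuclearRepresentation_of_countable {ι : Type*} [Countable ι] {r : ℝ}
    (hr0 : 0 < r) {T : E →L[ℂ] E} {x' : ι → E →L[ℂ] ℂ} {y : ι → E}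
    (hT : ∀ x, HasSum (fun i => x' i x • y i) (T x))
    (h : Summable fun i => ‖x' i‖ ^ r * ‖y i‖ ^ r) :
    ∃ (X' : ℕ → E →L[ℂ] ℂ) (Y : ℕ → E),
      IsNuclearRepresentation r T X' Y ∧ ∑' n, X' n (Y n) = ∑' i, x' i (y i) := by
  obtain ⟨e, he⟩ := exists_injective_nat ι
  let X' := Function.extend e x' 0
  let Y := Function.extend e y 0
  have hX' (i : ι) : X' (e i) = x' i := he.extend_apply _ _ _
  have hY (i : ι) : Y (e i) = y i := he.extend_apply _ _ _
  have hX'0 (n : ℕ) (hn : n ∉ Set.range e) : X' n = 0 := Function.extend_apply' _ _ _ hn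
  refine ⟨X', Y, ⟨fun x => ?_, ?_⟩, ?_⟩
  · rw [← he.hasSum_iff fun n hn => by simp [hX'0 n hn]]
    simpa only [Function.comp_def, hX', hY] using hT x
  · rw [← he.summable_iff fun n hn => by simp [hX'0 n hn, Real.zero_rpow hr0.ne']]
    simpa only [Function.comp_def, hX', hY] using h
  · rw [← he.tsum_eq (f := fun n => X' n (Y n)) fun n hn => by
      by_contra hn'
      exact hn (by simp [hX'0 n hn'])]
    simp only [hX', hY]

end NuclearTrace

section LpApproximation

open Filter Topology

theorem memLp_comp_of_finite {α κ E : Type*} [MeasurableSpace α] {μ : Measure α}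
    [IsFiniteMeasure μ] [NormedAddCommGroup E] [Finite κ] [MeasurableSpace κ]
    [DiscreteMeasurableSpace κ] {p : ℝ≥0∞} {S : α → κ} (hS : Measurable S) (g : κ → E) :
    MemLp (g ∘ S) p μ := by
  obtain ⟨C, hC⟩ := (Set.finite_range fun k => ‖g k‖).bddAbove
  exact MemLp.of_bound (StronglyMeasurable.of_discrete.comp_measurable hS).aestronglyMeasurable C
    (Eventually.of_forall fun a => hC ⟨S a, rfl⟩)

variable {α E : Type*} {m m0 : MeasurableSpace α} {μ : Measure α} {p : ℝ≥0∞}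
  [NormedAddCommGroup E] [NormedSpace ℂ E]

/-- The conditional expectation as an operator on `L^p`. The conditional expectations on finite
σ-algebras witness the bounded approximation property of `L^p`. -/
def condExpLp [CompleteSpace E] (p : ℝ≥0∞) [Fact (1 ≤ p)] (m : MeasurableSpace α)
    {m0 : MeasurableSpace α} (μ : Measure α) [IsFiniteMeasure μ] : Lp E p μ →L[ℂ] Lp E p μ :=
  LinearMap.mkContinuous
    { toFun := fun f => ((Lp.memLp f).condExp (m := m) Fact.out).toLp (μ[f | m])
      map_add' := fun f g => by
        rw [← MemLp.toLp_add, MemLp.toLp_eq_toLp_iff]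
        exact (condExp_congr_ae (Lp.coeFn_add f g)).trans
          (condExp_add ((Lp.memLp f).integrable Fact.out) ((Lp.memLp g).integrable Fact.out) m)
      map_smul' := fun c f => by
        rw [RingHom.id_apply, ← MemLp.toLp_const_smul, MemLp.toLp_eq_toLp_iff]
        exact (condExp_congr_ae (Lp.coeFn_smul c f)).trans (condExp_smul c _ m) }
    1 fun f => by
      rw [one_mul, LinearMap.coe_mk, AddHom.coe_mk, Lp.norm_toLp, Lp.norm_def]
      exact ENNReal.toReal_mono (Lp.eLpNorm_ne_top f) (eLpNorm_condExp_le_eLpNorm _ Fact.out)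

section

variable [IsFiniteMeasure μ] [Fact (1 ≤ p)]

theorem norm_condExpLp_le [CompleteSpace E] :
    ‖(condExpLp p m μ : Lp E p μ →L[ℂ] Lp E p μ)‖ ≤ 1 :=
  LinearMap.mkContinuous_norm_le _ zero_le_one _

theorem condExpLp_apply [CompleteSpace E] (f : Lp E p μ) :
    condExpLp p m μ f = ((Lp.memLp f).condExp (m := m) Fact.out).toLp (μ[f | m]) := rfl

theorem condExpLp_simpleFunc [CompleteSpace E] (hm : m ≤ m0) {g : Lp.simpleFunc E p μ}
    (hg : StronglyMeasurable[m] (Lp.simpleFunc.toSimpleFunc g)) :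
    condExpLp p m μ g = (g : Lp E p μ) := by
  have hg_mem := Lp.simpleFunc.memLp g
  have hg_toLp : hg_mem.toLp _ = (g : Lp E p μ) :=
    congrArg Subtype.val (Lp.simpleFunc.toLp_toSimpleFunc g)
  rw [← hg_toLp, condExpLp_apply, MemLp.toLp_eq_toLp_iff]
  refine (condExp_congr_ae hg_mem.coeFn_toLp).trans (.of_eq ?_)
  exact condExp_of_stronglyMeasurable hm hg (hg_mem.integrable Fact.out)

end

theorem finiteDimensional_range_condExpLp_comap [FiniteDimensional ℂ E] [CompleteSpace E]
    [IsFiniteMeasure μ] [Fact (1 ≤ p)] {β : Type*} [MeasurableSpace β]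
    [MeasurableSingletonClass β] {S : α → β} (hS : Measurable S) (hfin : (Set.range S).Finite) :
    FiniteDimensional ℂ
      (condExpLp p (MeasurableSpace.comap S ‹_›) μ : Lp E p μ →L[ℂ] Lp E p μ).range := by
  have : Finite (Set.range S) := hfin
  have hS' : Measurable (Set.rangeFactorization S) := hS.subtype_mk
  let Φ : (Set.range S → E) →ₗ[ℂ] Lp E p μ :=
    { toFun := fun g => (memLp_comp_of_finite hS' g).toLp _
      map_add' := fun _ _ => rfl
      map_smul' := fun _ _ => rfl }
  refine Submodule.finiteDimensional_of_le (S₂ := LinearMap.range Φ) ?_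
  rintro _ ⟨f, rfl⟩
  obtain ⟨g, -, hg⟩ := (stronglyMeasurable_condExp (μ := μ) (f := (f : α → E))
    (m := MeasurableSpace.comap S ‹_›)).exists_eq_measurable_comp
  exact ⟨fun b => g b, MemLp.toLp_congr (memLp_comp_of_finite hS' _)
    ((Lp.memLp f).condExp Fact.out) (.of_eq hg.symm)⟩

theorem hasBoundedApproximationProperty_Lp [FiniteDimensional ℂ E] [IsFiniteMeasure μ]
    [Fact (1 ≤ p)] (hp : p ≠ ⊤) : HasBoundedApproximationProperty (Lp E p μ) := by
  have : ProperSpace E := FiniteDimensional.proper ℂ E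
  borelize E
  let S (s : Finset (SimpleFunc α E)) (a : α) (f : s) : E := f.1 a
  have hS (s : Finset (SimpleFunc α E)) : Measurable (S s) :=
    measurable_pi_iff.2 fun f => f.1.measurable
  have hmeas (s : Finset (SimpleFunc α E)) (f : SimpleFunc α E) (hf : f ∈ s) :
      StronglyMeasurable[MeasurableSpace.comap (S s) inferInstance] f :=
    ((measurable_pi_apply (⟨f, hf⟩ : s)).comp (comap_measurable (S s))).stronglyMeasurable
  have hfin (s : Finset (SimpleFunc α E)) : (Set.range (S s)).Finite :=
    (Set.Finite.pi' fun f : s => f.1.finite_range).subset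
      (Set.range_subset_iff.2 fun a f => Set.mem_range_self a)
  let R (s : Finset (SimpleFunc α E)) : Lp E p μ →L[ℂ] Lp E p μ :=
    condExpLp p (MeasurableSpace.comap (S s) inferInstance) μ
  have hR (s : Finset (SimpleFunc α E)) : ‖R s‖ ≤ 1 := norm_condExpLp_le
  have hfix (g : Lp.simpleFunc E p μ) : ∀ᶠ s in atTop, R s g = g := by
    filter_upwards [eventually_ge_atTop {Lp.simpleFunc.toSimpleFunc g}] with s hgs
    exact condExpLp_simpleFunc (hS s).comap_le (hmeas s _ (Finset.singleton_subset_iff.1 hgs))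
  have hequi : Equicontinuous fun s => (R s : Lp E p μ → Lp E p μ) :=
    (LipschitzWith.uniformEquicontinuous _ 1 fun s =>
      (R s).lipschitz.weaken (hR s)).equicontinuous
  refine ⟨1, map R atTop, inferInstance, eventually_map.2 (.of_forall hR),
    eventually_map.2 (.of_forall fun s =>
      finiteDimensional_range_condExpLp_comap (hS s) (hfin s)), fun y => tendsto_map'_iff.2 ?_⟩
  exact (Lp.simpleFunc.denseRange hp).induction_on
    (p := fun y => Tendsto (fun s => R s y) atTop (𝓝 y)) y
    (hequi.isClosed_setOfPred_tendsto continuous_id) fun g => tendsto_const_nhds.congr' (by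
      filter_upwards [hfix g] with s hs using hs.symm)

end LpApproximation

section Schur

open Matrix ComplexConjugate ComplexOrder

namespace UnitaryIrrep

variable {G : Type*} [Group G] [TopologicalSpace G]

theorem mat_mul (ξ : UnitaryIrrep G) (x y : G) : ξ.mat (x * y) = ξ.mat x * ξ.mat y := by
  simp [mat]

theorem conjTranspose_mat_mul_mat (ξ : UnitaryIrrep G) (x : G) : (ξ.mat x)ᴴ * ξ.mat x = 1 :=
  Matrix.mem_unitaryGroup_iff'.1 (ξ.toHom x).2

theorem mat_inv (ξ : UnitaryIrrep G) (x : G) : ξ.mat x⁻¹ = (ξ.mat x)ᴴ := by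
  simp [mat, Matrix.star_eq_conjTranspose]

theorem norm_mat_apply_le_one (ξ : UnitaryIrrep G) (x : G) (i j : Fin ξ.dim) :
    ‖ξ.mat x i j‖ ≤ 1 :=
  entry_norm_bound_of_unitary (ξ.toHom x).2 i j

theorem coeff_apply (ξ : UnitaryIrrep G) (i j : Fin ξ.dim) (x : G) :
    ξ.coeff i j x = ξ.mat x i j := rfl

theorem dim_pos (ξ : UnitaryIrrep G) : 0 < ξ.dim := by
  have := ξ.irreducible_rep
  have : Nontrivial (Fin ξ.dim → ℂ) :=
    IsSimpleModule.nontrivial (MonoidAlgebra ℂ G) (matrixRepresentation ξ.toHom).asModule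
  exact Fin.pos_iff_nonempty.2 <| (isEmpty_or_nonempty _).resolve_left fun _ =>
    not_subsingleton (Fin ξ.dim → ℂ) inferInstance

theorem matrixRepresentation_apply (ξ : UnitaryIrrep G) (x : G) (v : Fin ξ.dim → ℂ) :
    matrixRepresentation ξ.toHom x v = ξ.mat x *ᵥ v := by
  simp [matrixRepresentation, mat]

theorem exists_eq_smul_one_of_commute (ξ : UnitaryIrrep G) {P : Matrix (Fin ξ.dim) (Fin ξ.dim) ℂ}
    (hP : ∀ x, ξ.mat x * P = P * ξ.mat x) : ∃ c : ℂ, P = c • 1 := by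
  have := ξ.irreducible_rep
  let f : (matrixRepresentation ξ.toHom).IntertwiningMap (matrixRepresentation ξ.toHom) :=
    LinearMap.intertwiningMap_of_isIntertwiningMap _ _ (Matrix.toLin' P) fun x v => by
      simp only [matrixRepresentation_apply, Matrix.toLin'_apply, Matrix.mulVec_mulVec, hP]
  obtain ⟨c, hc⟩ :=
    Representation.IsIrreducible.algebraMap_intertwiningMap_bijective_of_isAlgClosed.2 f
  refine ⟨c, Matrix.toLin'.injective ?_⟩
  have hf : Matrix.toLin' P = algebraMap ℂ (Module.End ℂ (Fin ξ.dim → ℂ)) c :=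
    (congrArg (fun f => f.toLinearMap) hc).symm
  rw [hf, map_smul, Matrix.toLin'_one, Module.algebraMap_end_eq_smul_id]

variable {ξ η : UnitaryIrrep G}

theorem mat_mul_conjTranspose_of_intertwines {P : Matrix (Fin ξ.dim) (Fin η.dim) ℂ}
    (hP : ∀ x, ξ.mat x * P = P * η.mat x) (x : G) : η.mat x * Pᴴ = Pᴴ * ξ.mat x := by
  simpa only [conjTranspose_mul, mat_inv, conjTranspose_conjTranspose] using
    (congrArg conjTranspose (hP x⁻¹)).symm

theorem exists_conjTranspose_mul_self_eq_smul_one {P : Matrix (Fin ξ.dim) (Fin η.dim) ℂ}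
    (hP : ∀ x, ξ.mat x * P = P * η.mat x) : ∃ t : ℝ, 0 ≤ t ∧ Pᴴ * P = t • 1 := by
  obtain ⟨c, hc⟩ := η.exists_eq_smul_one_of_commute (P := Pᴴ * P) fun x => by
    rw [← Matrix.mul_assoc, mat_mul_conjTranspose_of_intertwines hP, Matrix.mul_assoc, hP,
      Matrix.mul_assoc]
  have hc0 : 0 ≤ c := by
    simpa [hc] using (posSemidef_conjTranspose_mul_self P).diag_nonneg (i := ⟨0, η.dim_pos⟩)
  obtain ⟨t, rfl⟩ : ∃ t : ℝ, (t : ℂ) = c := ⟨c.re, (Complex.eq_re_of_ofReal_le hc0).symm⟩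
  exact ⟨t, Complex.zero_le_real.1 hc0, hc⟩

theorem eq_zero_of_not_equivalent (h : ¬ Equivalent ξ η) {P : Matrix (Fin ξ.dim) (Fin η.dim) ℂ}
    (hP : ∀ x, ξ.mat x * P = P * η.mat x) : P = 0 := by
  by_contra hP0
  have hP' := mat_mul_conjTranspose_of_intertwines hP
  obtain ⟨t, ht, hPP⟩ := exists_conjTranspose_mul_self_eq_smul_one hP
  obtain ⟨s, -, hPP'⟩ := exists_conjTranspose_mul_self_eq_smul_one hP'
  rw [conjTranspose_conjTranspose] at hPP'
  obtain rfl : s = t := smul_left_injective ℝ hP0 <| by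
    calc s • P = P * Pᴴ * P := by rw [hPP', Matrix.smul_mul, Matrix.one_mul]
      _ = t • P := by rw [Matrix.mul_assoc, hPP, Matrix.mul_smul, Matrix.mul_one]
  have hs : (√s)⁻¹ * ((√s)⁻¹ * s) = 1 := by
    have hs0 : s ≠ 0 := by
      rintro rfl
      exact hP0 (conjTranspose_mul_self_eq_zero.1 (by rw [hPP, zero_smul]))
    rw [← mul_assoc, ← mul_inv, Real.mul_self_sqrt ht, inv_mul_cancel₀ hs0]
  refine h ⟨(√s)⁻¹ • Pᴴ, ?_, ?_, fun x => ?_⟩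
  · simp [hPP', smul_smul, hs]
  · simp [hPP, smul_smul, hs]
  · rw [Matrix.smul_mul, Matrix.mul_smul, hP']

end UnitaryIrrep

theorem mul_integral_mul {α l m n o : Type*} [MeasurableSpace α] {μ : Measure α} [Fintype m]
    [Fintype n] {F : α → Matrix m n ℂ} (hF : ∀ i k, Integrable (fun x => F x i k) μ)
    (C : Matrix l m ℂ) (D : Matrix n o ℂ) :
    C * Matrix.of (fun i k => ∫ x, F x i k ∂μ) * D =
      Matrix.of fun i k => ∫ x, (C * F x * D) i k ∂μ := by
  ext i k
  simp only [Matrix.mul_apply, Matrix.of_apply]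
  rw [integral_finsetSum _ fun b _ => (integrable_finsetSum _ fun a _ =>
    (hF a b).const_mul _).mul_const _]
  refine Finset.sum_congr rfl fun b _ => ?_
  rw [integral_mul_const, integral_finsetSum _ fun a _ => (hF a b).const_mul _]
  simp only [integral_const_mul]

namespace UnitaryIrrep

variable {G : Type*} [Group G] [TopologicalSpace G] [MeasurableSpace G] (μ : Measure G)

/-- The average of `ξ(x) B η(x)^*` over the group. It intertwines `η` and `ξ`. -/
def averageMat (ξ η : UnitaryIrrep G) (B : Matrix (Fin ξ.dim) (Fin η.dim) ℂ) :
    Matrix (Fin ξ.dim) (Fin η.dim) ℂ :=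
  Matrix.of fun i k => ∫ x, (ξ.mat x * B * (η.mat x)ᴴ) i k ∂μ

theorem averageMat_single (ξ η : UnitaryIrrep G) (i j : Fin ξ.dim) (k l : Fin η.dim) :
    averageMat μ ξ η (Matrix.single j l 1) i k =
      ∫ x, ξ.coeff i j x * conj (η.coeff k l x) ∂μ := by
  simp [averageMat, coeff_apply, Matrix.mul_apply, Matrix.single_apply, ite_and]

variable [CompactSpace G] [BorelSpace G]

theorem integrable_mat_mul_mul_conjTranspose [IsFiniteMeasure μ] (ξ η : UnitaryIrrep G)
    (B : Matrix (Fin ξ.dim) (Fin η.dim) ℂ) (i : Fin ξ.dim) (k : Fin η.dim) :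
    Integrable (fun x => (ξ.mat x * B * (η.mat x)ᴴ) i k) μ :=
  (((ξ.continuous_mat.matrix_mul continuous_const).matrix_mul
    η.continuous_mat.matrix_conjTranspose).matrix_elem i k).integrable_of_hasCompactSupport
    (HasCompactSupport.of_compactSpace _)

theorem trace_averageMat [IsProbabilityMeasure μ] (ξ : UnitaryIrrep G)
    (B : Matrix (Fin ξ.dim) (Fin ξ.dim) ℂ) : (averageMat μ ξ ξ B).trace = B.trace := by
  have htrace (x : G) : (ξ.mat x * B * (ξ.mat x)ᴴ).trace = B.trace := by
    rw [Matrix.trace_mul_comm, ← Matrix.mul_assoc, conjTranspose_mat_mul_mat, Matrix.one_mul]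
  calc (averageMat μ ξ ξ B).trace = ∫ x, (ξ.mat x * B * (ξ.mat x)ᴴ).trace ∂μ :=
        (integral_finsetSum _ fun a _ => integrable_mat_mul_mul_conjTranspose μ ξ ξ B a a).symm
    _ = B.trace := by simp [htrace]

variable [IsTopologicalGroup G] [μ.IsMulLeftInvariant]

theorem mat_mul_averageMat [IsFiniteMeasure μ] (ξ η : UnitaryIrrep G)
    (B : Matrix (Fin ξ.dim) (Fin η.dim) ℂ) (g : G) :
    ξ.mat g * averageMat μ ξ η B = averageMat μ ξ η B * η.mat g := by
  have hinv : ξ.mat g * averageMat μ ξ η B * (η.mat g)ᴴ = averageMat μ ξ η B := by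
    rw [averageMat, mul_integral_mul (integrable_mat_mul_mul_conjTranspose μ ξ η B)]
    ext i k
    have htrans := integral_mul_left_eq_self (μ := μ)
      (fun x => (ξ.mat x * B * (η.mat x)ᴴ) i k) g
    simpa only [Matrix.of_apply, mat_mul, conjTranspose_mul, Matrix.mul_assoc] using htrans
  rw [← hinv, Matrix.mul_assoc _ _ (η.mat g), conjTranspose_mat_mul_mat, Matrix.mul_one, hinv]

theorem integral_coeff_mul_conj_of_not_equivalent [IsFiniteMeasure μ]
    {ξ η : UnitaryIrrep G} (h : ¬ Equivalent ξ η) (i j : Fin ξ.dim) (k l : Fin η.dim) :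
    ∫ x, ξ.coeff i j x * conj (η.coeff k l x) ∂μ = 0 := by
  rw [← averageMat_single, eq_zero_of_not_equivalent h (mat_mul_averageMat μ ξ η _),
    Matrix.zero_apply]

theorem integral_coeff_mul_conj_self [IsProbabilityMeasure μ] (ξ : UnitaryIrrep G)
    (i j k l : Fin ξ.dim) :
    ∫ x, ξ.coeff i j x * conj (ξ.coeff k l x) ∂μ =
      if i = k ∧ j = l then (ξ.dim : ℂ)⁻¹ else 0 := by
  obtain ⟨c, hc⟩ := ξ.exists_eq_smul_one_of_commute
    (mat_mul_averageMat μ ξ ξ (Matrix.single j l 1))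
  have hd : (ξ.dim : ℂ) ≠ 0 := Nat.cast_ne_zero.2 ξ.dim_pos.ne'
  have hcd : c * ξ.dim = if j = l then 1 else 0 := by
    have htr := trace_averageMat μ ξ (Matrix.single j l 1)
    rw [hc, Matrix.trace_smul, Matrix.trace_one, Fintype.card_fin, smul_eq_mul] at htr
    rw [htr]
    split_ifs with h
    · rw [h, Matrix.trace_single_eq_same]
    · exact Matrix.trace_single_eq_of_ne _ _ _ h
  rw [← averageMat_single, hc, Matrix.smul_apply, Matrix.one_apply, eq_div_of_mul_eq hd hcd]
  split_ifs <;> simp_all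

theorem integral_norm_coeff_sq [IsProbabilityMeasure μ] (ξ : UnitaryIrrep G) (i j : Fin ξ.dim) :
    ∫ x, ‖ξ.coeff i j x‖ ^ 2 ∂μ = (ξ.dim : ℝ)⁻¹ := by
  have h := ξ.integral_coeff_mul_conj_self μ i j i j
  simp only [and_self, if_true, Complex.mul_conj'] at h
  refine Complex.ofReal_injective ?_
  rw [← integral_complex_ofReal]
  push_cast
  exact h

/-- The indices `(a, i, j)` of the matrix coefficients `(rep a)_{ij}` of a family of
representations. -/
abbrev CoeffIndex {ι : Type*} (rep : ι → UnitaryIrrep G) : Type _ :=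
  Σ a, Fin (rep a).dim × Fin (rep a).dim

/-- The matrix coefficients of a family of representations. -/
def familyCoeff {ι : Type*} (rep : ι → UnitaryIrrep G) (k : CoeffIndex rep) : C(G, ℂ) :=
  (rep k.1).coeff k.2.1 k.2.2

open scoped Classical in
theorem integral_familyCoeff_mul_conj [IsProbabilityMeasure μ] {ι : Type*}
    {rep : ι → UnitaryIrrep G} (hrep : Pairwise fun a b => ¬ Equivalent (rep a) (rep b))
    (k l : CoeffIndex rep) :
    ∫ x, familyCoeff rep k x * conj (familyCoeff rep l x) ∂μ =
      if k = l then ((rep k.1).dim : ℂ)⁻¹ else 0 := by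
  obtain ⟨a, i, j⟩ := k
  obtain ⟨b, i', j'⟩ := l
  by_cases hab : a = b
  · subst hab
    simpa [familyCoeff] using integral_coeff_mul_conj_self μ (rep a) i j i' j'
  · simpa [familyCoeff, hab] using
      integral_coeff_mul_conj_of_not_equivalent μ (hrep hab) i j i' j'

theorem orthonormal_sqrt_dim_smul_familyCoeff [IsProbabilityMeasure μ] {ι : Type*}
    {rep : ι → UnitaryIrrep G} (hrep : Pairwise fun a b => ¬ Equivalent (rep a) (rep b)) :
    Orthonormal ℂ fun k : CoeffIndex rep =>
      ((√(rep k.1).dim : ℝ) : ℂ) • ContinuousMap.toLp 2 μ ℂ (familyCoeff rep k) := by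
  classical
  rw [orthonormal_iff_ite]
  intro k l
  rw [inner_smul_left, inner_smul_right, ContinuousMap.inner_toLp,
    integral_familyCoeff_mul_conj μ hrep]
  rcases eq_or_ne k l with rfl | hkl
  · have hd : ((rep k.1).dim : ℂ) ≠ 0 := Nat.cast_ne_zero.2 (rep k.1).dim_pos.ne'
    rw [if_pos rfl, if_pos rfl, Complex.conj_ofReal, ← mul_assoc, ← Complex.ofReal_mul,
      Real.mul_self_sqrt (Nat.cast_nonneg _), Complex.ofReal_natCast, mul_inv_cancel₀ hd]
  · rw [if_neg hkl, if_neg hkl.symm, mul_zero, mul_zero]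

end UnitaryIrrep

end Schur

section Countable

theorem countable_of_orthonormal {𝕜 ι E : Type*} [RCLike 𝕜] [NormedAddCommGroup E]
    [InnerProductSpace 𝕜 E] [TopologicalSpace.SeparableSpace E] {v : ι → E}
    (hv : Orthonormal 𝕜 v) : Countable ι := by
  have hdist {i j : ι} (hij : i ≠ j) : 1 ≤ dist (v i) (v j) := by
    have hsq : ‖v i - v j‖ ^ 2 = 2 := by
      rw [@norm_sub_sq 𝕜, hv.2 hij, hv.1, hv.1, map_zero]
      norm_num
    rw [dist_eq_norm]
    nlinarith [norm_nonneg (v i - v j)]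
  rw [← Set.countable_univ_iff]
  exact Set.PairwiseDisjoint.countable_of_isOpen (s := fun i => Metric.ball (v i) (1 / 2))
    (fun i _ j _ hij => Metric.ball_disjoint_ball (by linarith [hdist hij]))
    (fun i _ => Metric.isOpen_ball) (fun i _ => ⟨v i, Metric.mem_ball_self (by norm_num)⟩)

theorem UnitaryIrrep.countable_of_pairwise_not_equivalent {G : Type*} [Group G]
    [TopologicalSpace G] [IsTopologicalGroup G] [CompactSpace G] [SecondCountableTopology G]
    [MeasurableSpace G] [BorelSpace G] (μ : Measure G) [IsProbabilityMeasure μ]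
    [μ.IsMulLeftInvariant] {ι : Type*} {rep : ι → UnitaryIrrep G}
    (hrep : Pairwise fun a b => ¬ Equivalent (rep a) (rep b)) : Countable ι := by
  have : Fact ((2 : ℝ≥0∞) ≠ ⊤) := ⟨by simp⟩
  have : Countable (CoeffIndex rep) :=
    countable_of_orthonormal (orthonormal_sqrt_dim_smul_familyCoeff μ hrep)
  have hsurj : Function.Surjective (Sigma.fst : CoeffIndex rep → ι) := fun a =>
    ⟨⟨a, ⟨0, (rep a).dim_pos⟩, ⟨0, (rep a).dim_pos⟩⟩, rfl⟩
  exact hsurj.countable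

end Countable

section FiniteDimensionalRepresentations

/-- The linear span of the matrix coefficients of all continuous irreducible unitary
representations of `G`. -/
def coeffSpan (G : Type*) [Group G] [TopologicalSpace G] : Submodule ℂ C(G, ℂ) :=
  Submodule.span ℂ {f | ∃ (ξ : UnitaryIrrep G) (i j : Fin ξ.dim), f = ξ.coeff i j}

variable {G V : Type*} [Group G] [NormedAddCommGroup V] [InnerProductSpace ℂ V]
  (ρ : G →* (V ≃ₗᵢ[ℂ] V))

theorem unitaryHom_mul_apply (x y : G) (v : V) : ρ (x * y) v = ρ x (ρ y v) := by
  rw [map_mul]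
  rfl

theorem unitaryHom_apply_apply_inv (x : G) (v : V) : ρ x (ρ x⁻¹ v) = v := by
  rw [← unitaryHom_mul_apply, mul_inv_cancel, map_one, LinearIsometryEquiv.coe_one, id]

theorem unitaryHom_inv_apply_apply (x : G) (v : V) : ρ x⁻¹ (ρ x v) = v := by
  rw [← unitaryHom_mul_apply, inv_mul_cancel, map_one, LinearIsometryEquiv.coe_one, id]

theorem map_mem_orthogonal_of_invariant {ρ : G →* (V ≃ₗᵢ[ℂ] V)} {W : Submodule ℂ V}
    (hW : ∀ x, ∀ v ∈ W, ρ x v ∈ W) (x : G) {v : V} (hv : v ∈ Wᗮ) : ρ x v ∈ Wᗮ := by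
  intro u hu
  rw [← unitaryHom_apply_apply_inv ρ x u, (ρ x).inner_map_map]
  exact hv _ (hW x⁻¹ u hu)

/-- The restriction of a unitary representation to an invariant subspace. -/
def restrictInvariant {W : Submodule ℂ V} (hW : ∀ x, ∀ v ∈ W, ρ x v ∈ W) : G →* (W ≃ₗᵢ[ℂ] W) where
  toFun x :=
    { toLinearEquiv := .ofLinearMap ((ρ x).toLinearMap.restrict (hW x))
        ((ρ x⁻¹).toLinearMap.restrict (hW x⁻¹))
        (LinearMap.ext fun v => Subtype.ext (unitaryHom_apply_apply_inv ρ x v))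
        (LinearMap.ext fun v => Subtype.ext (unitaryHom_inv_apply_apply ρ x v))
      norm_map' := fun v => (ρ x).norm_map v }
  map_one' := by
    ext v
    exact congrArg (fun f : V ≃ₗᵢ[ℂ] V => f v) (map_one ρ)
  map_mul' x y := by
    ext v
    exact unitaryHom_mul_apply ρ x y v

/-- The unitary matrices of a finite-dimensional unitary representation in an orthonormal basis. -/
def unitaryMatrixHom {d : ℕ} (b : OrthonormalBasis (Fin d) ℂ V) :
    G →* Matrix.unitaryGroup (Fin d) ℂ where
  toFun x := ⟨LinearMap.toMatrix b.toBasis b.toBasis (ρ x).toLinearMap, by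
    convert b.toMatrix_orthonormalBasis_mem_unitary (b.map (ρ x))
    ext i j
    simp [LinearMap.toMatrix_apply, Module.Basis.toMatrix_apply]⟩
  map_one' := Subtype.ext <| by
    rw [map_one]
    exact LinearMap.toMatrix_one b.toBasis
  map_mul' x y := Subtype.ext <| by
    rw [map_mul]
    exact LinearMap.toMatrix_mul b.toBasis _ _

variable {d : ℕ} (b : OrthonormalBasis (Fin d) ℂ V)

theorem unitaryMatrixHom_apply_apply (x : G) (i j : Fin d) :
    (unitaryMatrixHom ρ b x : Matrix (Fin d) (Fin d) ℂ) i j = inner ℂ (b i) (ρ x (b j)) := by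
  simp [unitaryMatrixHom, LinearMap.toMatrix_apply, b.repr_apply_apply]

theorem matrixRepresentation_unitaryMatrixHom (x : G) (v : V) :
    matrixRepresentation (unitaryMatrixHom ρ b) x (b.toBasis.equivFun v) =
      b.toBasis.equivFun (ρ x v) := by
  rw [matrixRepresentation]
  exact LinearMap.toMatrix_mulVec_repr b.toBasis b.toBasis (ρ x).toLinearMap v

theorem isIrreducible_unitaryMatrixHom [Nontrivial V]
    (hirr : ∀ W : Submodule ℂ V, (∀ x, ∀ v ∈ W, ρ x v ∈ W) → W = ⊥ ∨ W = ⊤) :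
    (matrixRepresentation (unitaryMatrixHom ρ b)).IsIrreducible where
  exists_pair_ne := by
    have : Nontrivial (Fin d → ℂ) := b.toBasis.equivFun.symm.toEquiv.nontrivial
    exact ⟨⊥, ⊤, fun h => bot_ne_top (congrArg Subrepresentation.toSubmodule h)⟩
  eq_bot_or_eq_top U := by
    let e := b.toBasis.equivFun
    have hinv : ∀ x, ∀ v ∈ U.toSubmodule.comap e.toLinearMap,
        ρ x v ∈ U.toSubmodule.comap e.toLinearMap := fun x v hv => by
      have := U.apply_mem_toSubmodule x hv
      rwa [LinearEquiv.coe_coe, matrixRepresentation_unitaryMatrixHom] at this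
    have hcomap : Function.Injective (Submodule.comap e.toLinearMap) :=
      Submodule.comap_injective_of_surjective e.surjective
    refine (hirr _ hinv).imp (fun h => ?_) fun h => ?_ <;>
      refine Subrepresentation.toSubmodule_injective (hcomap (h.trans ?_))
    · exact e.ker.symm
    · rfl

variable [TopologicalSpace G] (hρ : ∀ v, Continuous fun x => ρ x v)

/-- The matrix coefficient `x ↦ ⟪w, ρ(x) v⟫`. -/
def matrixCoeff (w v : V) : C(G, ℂ) where
  toFun x := inner ℂ w (ρ x v)
  continuous_toFun := continuous_const.inner (hρ v)

theorem matrixCoeff_mem_coeffSpan_of_irreducible [FiniteDimensional ℂ V] [Nontrivial V]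
    (hirr : ∀ W : Submodule ℂ V, (∀ x, ∀ v ∈ W, ρ x v ∈ W) → W = ⊥ ∨ W = ⊤) (w v : V) :
    matrixCoeff ρ hρ w v ∈ coeffSpan G := by
  let b := stdOrthonormalBasis ℂ V
  let ξ : UnitaryIrrep G := ⟨_, unitaryMatrixHom ρ b,
    continuous_matrix fun i j => by
      simpa only [unitaryMatrixHom_apply_apply] using continuous_const.inner (hρ (b j)),
    isIrreducible_unitaryMatrixHom ρ b hirr⟩
  have hexp : matrixCoeff ρ hρ w v =
      ∑ i, ∑ j, (inner ℂ w (b i) * inner ℂ (b j) v) • ξ.coeff i j := by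
    ext x
    have hcoeff (i j) : ξ.coeff i j x = inner ℂ (b i) (ρ x (b j)) :=
      unitaryMatrixHom_apply_apply ρ b x i j
    have hv : ρ x v = ∑ j, inner ℂ (b j) v • ρ x (b j) := by
      conv_lhs => rw [← b.sum_repr' v, map_sum]
      simp only [map_smul]
    calc inner ℂ w (ρ x v) = ∑ i, inner ℂ w (b i) * inner ℂ (b i) (ρ x v) :=
          (b.sum_inner_mul_inner w (ρ x v)).symm
      _ = ∑ i, ∑ j, inner ℂ w (b i) * inner ℂ (b j) v * inner ℂ (b i) (ρ x (b j)) := by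
          simp only [hv, inner_sum, inner_smul_right, Finset.mul_sum, mul_assoc]
      _ = _ := by simp [hcoeff]
  rw [hexp]
  exact Submodule.sum_mem _ fun i _ => Submodule.sum_mem _ fun j _ =>
    Submodule.smul_mem _ _ (Submodule.subset_span ⟨ξ, i, j, rfl⟩)

theorem matrixCoeff_mem_coeffSpan [FiniteDimensional ℂ V] (w v : V) :
    matrixCoeff ρ hρ w v ∈ coeffSpan G := by
  induction hn : Module.finrank ℂ V using Nat.strong_induction_on generalizing V with
  | _ n ih =>
  subst hn
  cases subsingleton_or_nontrivial V with
  | inl _ =>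
    convert (coeffSpan G).zero_mem
    ext x
    simp [matrixCoeff, Subsingleton.elim v 0]
  | inr _ =>
  by_cases hirr : ∀ W : Submodule ℂ V, (∀ x, ∀ v ∈ W, ρ x v ∈ W) → W = ⊥ ∨ W = ⊤
  · exact matrixCoeff_mem_coeffSpan_of_irreducible ρ hρ hirr w v
  push Not at hirr
  obtain ⟨W, hW, hW0, hW1⟩ := hirr
  have ih' {U : Submodule ℂ V} (hU : ∀ x, ∀ v ∈ U, ρ x v ∈ U) (hU1 : U ≠ ⊤) (a c : U) :
      matrixCoeff ρ hρ a c ∈ coeffSpan G :=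
    ih _ (Submodule.finrank_lt hU1) (restrictInvariant ρ hU)
      (fun v => (hρ v).subtype_mk _) a c rfl
  have hW' : ∀ x, ∀ v ∈ Wᗮ, ρ x v ∈ Wᗮ := fun x v => map_mem_orthogonal_of_invariant hW x
  obtain ⟨w₁, hw₁, w₂, hw₂, rfl⟩ := W.exists_add_mem_mem_orthogonal w
  obtain ⟨v₁, hv₁, v₂, hv₂, rfl⟩ := W.exists_add_mem_mem_orthogonal v
  have hsplit : matrixCoeff ρ hρ (w₁ + w₂) (v₁ + v₂) =
      matrixCoeff ρ hρ w₁ v₁ + matrixCoeff ρ hρ w₂ v₂ := by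
    ext x
    have h₁₂ : inner ℂ w₁ (ρ x v₂) = 0 := hW' x v₂ hv₂ w₁ hw₁
    have h₂₁ : inner ℂ w₂ (ρ x v₁) = 0 := inner_eq_zero_symm.1 (hw₂ _ (hW x v₁ hv₁))
    simp [matrixCoeff, h₁₂, h₂₁]
  rw [hsplit]
  exact (coeffSpan G).add_mem (ih' hW hW1 ⟨w₁, hw₁⟩ ⟨v₁, hv₁⟩)
    (ih' hW' (mt W.orthogonal_eq_top_iff.1 hW0) ⟨w₂, hw₂⟩ ⟨v₂, hv₂⟩)

end FiniteDimensionalRepresentations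

section PeterWeyl

open Filter Topology ComplexConjugate

section InnerKernel

variable {𝕜 X H : Type*} [RCLike 𝕜] [TopologicalSpace X] [CompactSpace X] [NormedAddCommGroup H]
  [InnerProductSpace 𝕜 H]

variable (𝕜) in
/-- The operator `f ↦ (x ↦ ⟪K x, f⟫)` with vector-valued kernel `K`. -/
def innerKernelMap (K : C(X, H)) : H →L[𝕜] C(X, 𝕜) :=
  LinearMap.mkContinuous
    { toFun := fun f => ⟨fun x => inner 𝕜 (K x) f, by fun_prop⟩
      map_add' := fun f g => by ext x; simp [inner_add_right]
      map_smul' := fun c f => by ext x; simp [inner_smul_right] }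
    ‖K‖ fun f => (ContinuousMap.norm_le _ (by positivity)).2 fun x =>
      (norm_inner_le_norm _ _).trans (by gcongr; exact K.norm_coe_le_norm x)

theorem isCompactOperator_innerKernelMap (K : C(X, H)) :
    IsCompactOperator (innerKernelMap 𝕜 K) := by
  let e := ContinuousMap.linearIsometryBoundedOfCompact X 𝕜 𝕜
  let S := (fun f => e (innerKernelMap 𝕜 K f)) '' Metric.ball 0 1
  have hS : IsCompact (closure S) := by
    refine BoundedContinuousFunction.arzela_ascoli (Metric.closedBall (0 : 𝕜) ‖K‖)
      (isCompact_closedBall _ _) S ?_ fun x₀ => ?_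
    · rintro _ x ⟨f, hf, rfl⟩
      rw [mem_ball_zero_iff] at hf
      rw [mem_closedBall_zero_iff]
      calc ‖inner 𝕜 (K x) f‖ ≤ ‖K x‖ * ‖f‖ := norm_inner_le_norm _ _
        _ ≤ ‖K‖ * 1 := by gcongr; exact K.norm_coe_le_norm x
        _ = ‖K‖ := mul_one _
    · rw [Metric.equicontinuousAt_iff_right]
      intro ε hε
      filter_upwards [Metric.tendsto_nhds.1 (K.continuous.tendsto x₀) ε hε]
      rintro x hx ⟨_, f, hf, rfl⟩
      rw [mem_ball_zero_iff] at hf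
      rw [dist_comm] at hx
      calc dist (inner 𝕜 (K x₀) f) (inner 𝕜 (K x) f) = ‖inner 𝕜 (K x₀ - K x) f‖ := by
            rw [dist_eq_norm, inner_sub_left]
        _ ≤ dist (K x₀) (K x) * ‖f‖ := (norm_inner_le_norm _ _).trans_eq (by rw [dist_eq_norm])
        _ < ε := (mul_le_of_le_one_right dist_nonneg hf.le).trans_lt hx
  refine (isCompactOperator_iff_image_ball_subset_compact (innerKernelMap 𝕜 K).toLinearMap
    one_pos).2 ⟨e.symm '' closure S, hS.image e.symm.continuous, ?_⟩
  rintro _ ⟨f, hf, rfl⟩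
  exact ⟨_, subset_closure ⟨f, hf, rfl⟩, e.symm_apply_apply _⟩

end InnerKernel

variable {G : Type*} [Group G] [TopologicalSpace G] [IsTopologicalGroup G] [CompactSpace G]

section MatrixCoeff

variable {V : Type*} [NormedAddCommGroup V] [InnerProductSpace ℂ V] (ρ : G →* (V ≃ₗᵢ[ℂ] V))
  (hρ : ∀ v, Continuous fun x => ρ x v)

/-- The map sending `v` to the matrix coefficient `x ↦ ⟪w, ρ(x) v⟫ = ⟪ρ(x⁻¹) w, v⟫`. -/
def matrixCoeffMap (w : V) : V →L[ℂ] C(G, ℂ) :=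
  innerKernelMap ℂ ⟨fun x => ρ x⁻¹ w, (hρ w).comp continuous_inv⟩

theorem matrixCoeffMap_apply (w v : V) : matrixCoeffMap ρ hρ w v = matrixCoeff ρ hρ w v := by
  ext x
  change inner ℂ (ρ x⁻¹ w) v = inner ℂ w (ρ x v)
  rw [← (ρ x).inner_map_map, unitaryHom_apply_apply_inv]

end MatrixCoeff

theorem exists_nhds_one_norm_mul_sub_le (f : C(G, ℂ)) {ε : ℝ} (hε : 0 < ε) :
    ∃ U ∈ 𝓝 (1 : G), ∀ u ∈ U, ∀ x, ‖f (u * x) - f x‖ ≤ ε := by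
  let F : C(G, C(G, ℂ)) := ContinuousMap.curry ⟨fun z : G × G => f (z.1 * z.2), by fun_prop⟩
  refine ⟨_, Metric.tendsto_nhds.1 (F.continuous.tendsto 1) ε hε, fun u hu x => ?_⟩
  have hux : ‖f (u * x) - f (1 * x)‖ ≤ dist (F u) (F 1) :=
    (dist_eq_norm (F u x) (F 1 x)).symm.trans_le (ContinuousMap.dist_apply_le_dist x)
  simpa only [one_mul] using hux.trans (le_of_lt hu)

variable [MeasurableSpace G] [BorelSpace G] (μ : Measure G) [IsFiniteMeasure μ]

theorem exists_symmetric_bump [μ.IsOpenPosMeasure] {U : Set G} (hU : U ∈ 𝓝 (1 : G)) :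
    ∃ k : C(G, ℝ), (∀ x, 0 ≤ k x) ∧ (∀ x, k x⁻¹ = k x) ∧ (∀ x, x ∉ U → k x = 0) ∧
      ∫ x, k x ∂μ = 1 := by
  obtain ⟨φ, hφ1, hφ0, hφ⟩ := exists_continuous_one_zero_of_isCompact
    (isCompact_singleton (x := (1 : G))) (isOpen_interior (s := U)).isClosed_compl
    (by simpa [Set.disjoint_singleton_left] using mem_interior_iff_mem_nhds.2 hU)
  let k : C(G, ℝ) := ⟨fun x => φ x * φ x⁻¹, by fun_prop⟩
  have hk0 : ∀ x, 0 ≤ k x := fun x => mul_nonneg (hφ.2 x).1 (hφ.2 x⁻¹).1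
  have hk1 : k 1 ≠ 0 := by
    have hφ1 : φ 1 = 1 := hφ1 (Set.mem_singleton 1)
    simp [k, hφ1]
  have hpos : 0 < ∫ x, k x ∂μ :=
    k.continuous.integral_pos_of_hasCompactSupport_nonneg_nonzero
      (HasCompactSupport.of_compactSpace _) hk0 hk1
  refine ⟨(∫ x, k x ∂μ)⁻¹ • k, fun x => mul_nonneg (inv_nonneg.2 hpos.le) (hk0 x), fun x => ?_,
    fun x hx => ?_, ?_⟩
  · simp [k, mul_comm]
  · have hφx : φ x = 0 := hφ0 fun hx' => hx (interior_subset hx')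
    simp [k, hφx]
  · simp only [ContinuousMap.smul_apply, smul_eq_mul]
    rw [integral_const_mul, inv_mul_cancel₀ hpos.ne']

theorem norm_integral_mul_ofReal_sub_le {X : Type*} [MeasurableSpace X] {ν : Measure X}
    {g : X → ℂ} {k : X → ℝ} {c : ℂ} {ε : ℝ} (hk : ∀ y, 0 ≤ k y) (hk1 : ∫ y, k y ∂ν = 1)
    (hgk : Integrable (fun y => g y * k y) ν) (hg : ∀ y, k y ≠ 0 → ‖g y - c‖ ≤ ε) :
    ‖∫ y, g y * k y ∂ν - c‖ ≤ ε := by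
  have hki : Integrable k ν := .of_integral_ne_zero (by rw [hk1]; exact one_ne_zero)
  have hc : ∫ y, c * (k y : ℂ) ∂ν = c := by
    rw [integral_const_mul, integral_complex_ofReal, hk1, Complex.ofReal_one, mul_one]
  calc ‖∫ y, g y * k y ∂ν - c‖ = ‖∫ y, (g y - c) * k y ∂ν‖ := by
        have hck : Integrable (fun y => c * (k y : ℂ)) ν := hki.ofReal.const_mul c
        simp only [sub_mul]
        rw [integral_sub hgk hck, hc]
    _ ≤ ∫ y, ε * k y ∂ν := by
        refine norm_integral_le_of_norm_le (hki.const_mul ε) (.of_forall fun y => ?_)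
        rw [norm_mul, Complex.norm_real, Real.norm_of_nonneg (hk y)]
        rcases eq_or_ne (k y) 0 with hy | hy
        · simp [hy]
        · exact mul_le_mul_of_nonneg_right (hg y hy) (hk y)
    _ = ε := by rw [integral_const_mul, hk1, mul_one]

variable [μ.IsMulRightInvariant]

/-- The right regular representation `(R(x) f)(y) = f(yx)` on `L²`. -/
def rightRegular : G →* (Lp ℂ 2 μ ≃ₗᵢ[ℂ] Lp ℂ 2 μ) where
  toFun x :=
    { toLinearEquiv := DistribMulAction.toLinearEquiv ℂ _ (DomMulAct.mk (MulOpposite.op x))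
      norm_map' := fun f => DomMulAct.norm_smul_Lp _ f }
  map_one' := by
    ext1 f
    exact one_smul Gᵐᵒᵖᵈᵐᵃ f
  map_mul' x y := by
    ext1 f
    exact mul_smul (DomMulAct.mk (MulOpposite.op x)) (DomMulAct.mk (MulOpposite.op y)) f

theorem continuous_rightRegular [μ.InnerRegularCompactLTTop] (f : Lp ℂ 2 μ) :
    Continuous fun x => rightRegular μ x f := by
  let mulRight : C(G, C(G, G)) := ContinuousMap.curry ⟨fun z : G × G => z.2 * z.1, by fun_prop⟩
  exact continuous_const.compMeasurePreservingLp mulRight.continuous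
    (measurePreserving_mul_right μ) (by simp)

theorem rightRegular_toLp (x : G) (f : C(G, ℂ)) :
    rightRegular μ x (ContinuousMap.toLp 2 μ ℂ f) =
      ContinuousMap.toLp 2 μ ℂ (f.comp ⟨fun y => y * x, by fun_prop⟩) :=
  rfl

variable [μ.InnerRegularCompactLTTop]

/-- The convolution operator `f ↦ (x ↦ ∫ conj (h y) f(yx) dy)`, expressed through the right regular
representation. -/
def convOp (h : Lp ℂ 2 μ) : Lp ℂ 2 μ →L[ℂ] C(G, ℂ) :=
  matrixCoeffMap (rightRegular μ) (continuous_rightRegular μ) h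

/-- `convOp` as an operator on `L²`. It is compact and commutes with the right regular
representation, so its eigenspaces for nonzero eigenvalues are finite-dimensional and invariant. -/
def convOpLp (h : Lp ℂ 2 μ) : Lp ℂ 2 μ →L[ℂ] Lp ℂ 2 μ :=
  (ContinuousMap.toLp 2 μ ℂ).comp (convOp μ h)

theorem convOp_apply (h f : Lp ℂ 2 μ) :
    convOp μ h f = matrixCoeff (rightRegular μ) (continuous_rightRegular μ) h f :=
  matrixCoeffMap_apply _ _ h f

theorem isCompactOperator_convOpLp (h : Lp ℂ 2 μ) : IsCompactOperator (convOpLp μ h) :=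
  (isCompactOperator_innerKernelMap _).clm_comp (ContinuousMap.toLp 2 μ ℂ)

theorem convOpLp_rightRegular (h f : Lp ℂ 2 μ) (x : G) :
    convOpLp μ h (rightRegular μ x f) = rightRegular μ x (convOpLp μ h f) := by
  simp only [convOpLp, ContinuousLinearMap.comp_apply, convOp_apply, rightRegular_toLp]
  congr 1
  ext y
  exact congrArg (inner ℂ h) (unitaryHom_mul_apply (rightRegular μ) y x f).symm

theorem convOp_toLp_apply (k f : C(G, ℂ)) (x : G) :
    convOp μ (ContinuousMap.toLp 2 μ ℂ k) (ContinuousMap.toLp 2 μ ℂ f) x =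
      ∫ y, f (y * x) * conj (k y) ∂μ := by
  rw [convOp_apply]
  exact (congrArg _ (rightRegular_toLp μ x f)).trans (ContinuousMap.inner_toLp ..)

theorem isSymmetric_convOpLp (k : C(G, ℂ)) (hk : ∀ x, k x⁻¹ = conj (k x)) :
    (convOpLp μ (ContinuousMap.toLp 2 μ ℂ k)).IsSymmetric := by
  intro f g
  have hd : DenseRange (ContinuousMap.toLp (E := ℂ) 2 μ ℂ) :=
    ContinuousMap.toLp_denseRange ℂ μ ℂ (by simp)
  refine DenseRange.induction_on₂ (p := fun f g =>
    inner ℂ (convOpLp μ (ContinuousMap.toLp 2 μ ℂ k) f) g =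
      inner ℂ f (convOpLp μ (ContinuousMap.toLp 2 μ ℂ k) g)) hd
    (isClosed_eq (by fun_prop) (by fun_prop)) (fun f g => ?_) f g
  have hconv (f : C(G, ℂ)) (x : G) :
      convOp μ (ContinuousMap.toLp 2 μ ℂ k) (ContinuousMap.toLp 2 μ ℂ f) x =
        ∫ y, f y * k (x * y⁻¹) ∂μ := by
    rw [convOp_toLp_apply, ← integral_mul_right_eq_self _ x⁻¹]
    simp [← hk]
  have hcont : Continuous fun z : G × G => g z.1 * (conj (f z.2) * k (z.2 * z.1⁻¹)) := by fun_prop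
  simp only [convOpLp, ContinuousLinearMap.comp_apply, ContinuousMap.inner_toLp, hconv]
  calc ∫ x, g x * conj (∫ y, f y * k (x * y⁻¹) ∂μ) ∂μ
      = ∫ x, ∫ y, g x * (conj (f y) * k (y * x⁻¹)) ∂μ ∂μ := by
        simp only [← integral_conj, map_mul, integral_const_mul, ← hk, mul_inv_rev, inv_inv]
    _ = ∫ y, ∫ x, g x * (conj (f y) * k (y * x⁻¹)) ∂μ ∂μ :=
        integral_integral_swap_of_hasCompactSupport hcont (HasCompactSupport.of_compactSpace _)
    _ = ∫ y, (∫ x, g x * k (y * x⁻¹) ∂μ) * conj (f y) ∂μ := by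
        simp only [← integral_mul_const, mul_right_comm, ← mul_assoc]

theorem convOp_mem_coeffSpan_of_eigenvector {h f : Lp ℂ 2 μ} {c : ℂ} (hc : c ≠ 0)
    (hf : convOpLp μ h f = c • f) : convOp μ h f ∈ coeffSpan G := by
  let W := Module.End.eigenspace (convOpLp μ h).toLinearMap c
  have hfW : f ∈ W := Module.End.mem_eigenspace_iff.2 hf
  have : FiniteDimensional ℂ W :=
    ContinuousLinearMap.finite_dimensional_eigenspace (isCompactOperator_convOpLp μ h) c hc
  have hW : ∀ x, ∀ v ∈ W, rightRegular μ x v ∈ W := fun x v hv => by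
    have hv' : convOpLp μ h v = c • v := Module.End.mem_eigenspace_iff.1 hv
    refine Module.End.mem_eigenspace_iff.2 ?_
    rw [ContinuousLinearMap.coe_coe, convOpLp_rightRegular, hv', map_smul]
  obtain ⟨a, ha, b, hb, rfl⟩ := W.exists_add_mem_mem_orthogonal h
  have hrestrict : convOp μ (a + b) f = matrixCoeff (restrictInvariant (rightRegular μ) hW)
      (fun v => (continuous_rightRegular μ v).subtype_mk _) ⟨a, ha⟩ ⟨f, hfW⟩ := by
    ext x
    have hb' : inner ℂ b (rightRegular μ x f) = 0 := inner_eq_zero_symm.1 (hb _ (hW x f hfW))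
    rw [convOp_apply]
    change inner ℂ (a + b) (rightRegular μ x f) = inner ℂ a (rightRegular μ x f)
    rw [inner_add_left, hb', add_zero]
  rw [hrestrict]
  exact matrixCoeff_mem_coeffSpan _ _ _ _

theorem convOp_mem_closure_coeffSpan [μ.IsOpenPosMeasure] (k : C(G, ℂ))
    (hk : ∀ x, k x⁻¹ = conj (k x)) (f : Lp ℂ 2 μ) :
    convOp μ (ContinuousMap.toLp 2 μ ℂ k) f ∈ (coeffSpan G).topologicalClosure := by
  set h := ContinuousMap.toLp 2 μ ℂ k
  let N : Submodule ℂ (Lp ℂ 2 μ) :=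
    (coeffSpan G).topologicalClosure.comap (convOp μ h).toLinearMap
  have hN : IsClosed (N : Set (Lp ℂ 2 μ)) :=
    (coeffSpan G).isClosed_topologicalClosure.preimage (convOp μ h).continuous
  have hle : (⨆ c, Module.End.eigenspace (convOpLp μ h).toLinearMap c) ≤ N := by
    refine iSup_le fun c f hf => ?_
    have hf' : convOpLp μ h f = c • f := Module.End.mem_eigenspace_iff.1 hf
    change convOp μ h f ∈ (coeffSpan G).topologicalClosure
    rcases eq_or_ne c 0 with rfl | hc
    · have h0 : convOp μ h f = 0 := ContinuousMap.toLp_injective (p := 2) (𝕜 := ℂ) μ <| by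
        rw [map_zero, ← zero_smul ℂ f, ← hf']
        rfl
      rw [h0]
      exact Submodule.zero_mem _
    · exact Submodule.le_topologicalClosure _ (convOp_mem_coeffSpan_of_eigenvector μ hc hf')
  have htop := Submodule.topologicalClosure_minimal _ hle hN
  rw [Submodule.topologicalClosure_eq_top_iff.2
    (ContinuousLinearMap.orthogonalComplement_iSup_eigenspaces_eq_bot
      (isCompactOperator_convOpLp μ h) (isSymmetric_convOpLp μ k hk))] at htop
  exact htop (Submodule.mem_top (x := f))

/-- The **Peter–Weyl theorem**: `f` is approximated by its convolutions with bump functions at `1`,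
and a convolution by the images of eigenvectors, which are matrix coefficients. -/
theorem topologicalClosure_coeffSpan_eq_top [μ.IsOpenPosMeasure] :
    (coeffSpan G).topologicalClosure = ⊤ := by
  rw [eq_top_iff]
  intro f _
  rw [← SetLike.mem_coe, Submodule.topologicalClosure_coe, ← closure_closure,
    Metric.mem_closure_iff]
  intro ε hε
  obtain ⟨U, hU, hUf⟩ := exists_nhds_one_norm_mul_sub_le f (half_pos hε)
  obtain ⟨k, hk0, hkinv, hkU, hk1⟩ := exists_symmetric_bump μ hU
  let k' : C(G, ℂ) := ⟨fun x => (k x : ℂ), by fun_prop⟩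
  have hk' (x : G) : conj (k' x) = k x := Complex.conj_ofReal _
  refine ⟨_, convOp_mem_closure_coeffSpan μ k'
    (fun x => (congrArg Complex.ofReal (hkinv x)).trans (hk' x).symm)
    (ContinuousMap.toLp 2 μ ℂ f), ?_⟩
  rw [dist_comm, dist_eq_norm]
  refine ((ContinuousMap.norm_le _ (half_pos hε).le).2 fun x => ?_).trans_lt (half_lt_self hε)
  rw [ContinuousMap.sub_apply, convOp_toLp_apply]
  simp only [hk']
  refine norm_integral_mul_ofReal_sub_le hk0 hk1 ?_ fun y hy => hUf y (not_imp_comm.1 (hkU y) hy) x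
  exact Continuous.integrable_of_hasCompactSupport (by fun_prop)
    (HasCompactSupport.of_compactSpace _)

theorem dense_toLp_image_coeffSpan [μ.IsOpenPosMeasure] {p : ℝ≥0∞} [Fact (1 ≤ p)]
    [μ.WeaklyRegular] (hp : p ≠ ⊤) :
    Dense (ContinuousMap.toLp (E := ℂ) p μ ℂ '' (coeffSpan G : Set C(G, ℂ))) :=
  (ContinuousMap.toLp_denseRange ℂ μ ℂ hp).dense_image (ContinuousMap.toLp p μ ℂ).continuous
    (Submodule.dense_iff_topologicalClosure_eq_top.2 (topologicalClosure_coeffSpan_eq_top μ))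

end PeterWeyl

section Integration

variable {X : Type*} [MeasurableSpace X] {μ : Measure X}

theorem ae_summable_of_summable_integral_norm {ι E : Type*} [Countable ι] [NormedAddCommGroup E]
    [CompleteSpace E] {g : ι → X → E} (hg : ∀ i, Integrable (g i) μ)
    (h : Summable fun i => ∫ x, ‖g i x‖ ∂μ) : ∀ᵐ x ∂μ, Summable fun i => g i x := by
  have hlint : ∫⁻ x, ∑' i, ‖g i x‖ₑ ∂μ ≠ ⊤ := by
    rw [lintegral_tsum fun i => (hg i).1.enorm]
    simpa only [ofReal_integral_norm_eq_lintegral_enorm (hg _)] using h.tsum_ofReal_ne_top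
  filter_upwards [ae_lt_top' (AEMeasurable.tsum fun i => (hg i).1.enorm) hlint] with x hx
  exact Summable.of_enorm hx.ne

theorem integrable_tsum_of_summable_integral_norm {ι E : Type*} [Countable ι]
    [NormedAddCommGroup E] [CompleteSpace E] {g : ι → X → E} (hg : ∀ i, Integrable (g i) μ)
    (h : Summable fun i => ∫ x, ‖g i x‖ ∂μ) : Integrable (fun x => ∑' i, g i x) μ := by
  have hmeas : AEStronglyMeasurable (fun x => ∑' i, g i x) μ := by
    refine aestronglyMeasurable_of_tendsto_ae (Filter.atTop : Filter (Finset ι))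
      (f := fun s x => ∑ i ∈ s, g i x)
      (fun s => Finset.aestronglyMeasurable_fun_sum s fun i _ => (hg i).1) ?_
    filter_upwards [ae_summable_of_summable_integral_norm hg h] with x hx using hx.hasSum
  refine ⟨hmeas, ?_⟩
  calc ∫⁻ x, ‖∑' i, g i x‖ₑ ∂μ ≤ ∫⁻ x, ∑' i, ‖g i x‖ₑ ∂μ :=
        lintegral_mono fun x => enorm_tsum_le_tsum_enorm
    _ = ∑' i, ENNReal.ofReal (∫ x, ‖g i x‖ ∂μ) := by
        rw [lintegral_tsum fun i => (hg i).1.enorm]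
        simp only [ofReal_integral_norm_eq_lintegral_enorm (hg _)]
    _ < ⊤ := h.tsum_ofReal_ne_top.lt_top

theorem lintegral_enorm_mul_le_of_norm_le_one {𝕜 : Type*} [NormedField 𝕜] {φ f : X → 𝕜}
    {p : ℝ≥0∞} (hp1 : 1 ≤ p) (hp2 : p ≤ 2) (hφ : AEStronglyMeasurable φ μ)
    (hf : AEStronglyMeasurable f μ) (hφ1 : ∀ x, ‖φ x‖ ≤ 1) :
    ∫⁻ x, ‖φ x * f x‖ₑ ∂μ ≤
      (∫⁻ x, ‖φ x‖ₑ ^ (2 : ℝ) ∂μ) ^ (1 - p.toReal⁻¹) * eLpNorm f p μ := by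
  have hp0 : p ≠ 0 := (zero_lt_one.trans_le hp1).ne'
  have hpt : p ≠ ⊤ := ne_top_of_le_ne_top (by simp) hp2
  set s := p.toReal
  have hs1 : 1 ≤ s := by simpa using ENNReal.toReal_mono hpt hp1
  have hs2 : s ≤ 2 := by simpa using ENNReal.toReal_mono (by simp) hp2
  have hs0 : s ≠ 0 := by positivity
  have hsinv : s⁻¹ ≤ 1 := inv_le_one_of_one_le₀ hs1
  have hexp : 2 * (1 - s⁻¹) ≤ 1 := by
    have := inv_anti₀ (by positivity) hs2
    linarith
  -- The conjugate exponent `q` of `p` is at least `2`, so `|φ| ≤ 1` gives `|φ| ^ q ≤ |φ| ^ 2`.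
  have hpointwise (x : X) :
      ‖φ x * f x‖ₑ ≤ (‖φ x‖ₑ ^ (2 : ℝ)) ^ (1 - s⁻¹) * (‖f x‖ₑ ^ s) ^ s⁻¹ := by
    have hφx : ‖φ x‖ₑ ≤ 1 := by
      rw [← ofReal_norm]
      exact ENNReal.ofReal_le_one.2 (hφ1 x)
    rw [enorm_mul, ← ENNReal.rpow_mul, ENNReal.rpow_rpow_inv hs0]
    gcongr
    simpa only [ENNReal.rpow_one] using ENNReal.rpow_le_rpow_of_exponent_ge hφx hexp
  rw [eLpNorm_eq_lintegral_rpow_enorm_toReal hp0 hpt, one_div]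
  exact (lintegral_mono hpointwise).trans <| ENNReal.lintegral_mul_norm_pow_le
    (hφ.enorm.pow_const _) (hf.enorm.pow_const _) (by linarith) (by positivity) (by ring)

end Integration

section ConjIntegral

open ComplexConjugate

variable {X : Type*} [TopologicalSpace X] [CompactSpace X] [MeasurableSpace X] [BorelSpace X]
  (μ : Measure X) [IsFiniteMeasure μ] {p : ℝ≥0∞} [Fact (1 ≤ p)]

/-- The functional `f ↦ ∫ conj φ f dμ` on `L^p`, for a continuous function `φ`. -/
def conjIntegral (φ : C(X, ℂ)) : Lp ℂ p μ →L[ℂ] ℂ :=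
  have : p.conjExponent.HolderConjugate p := (ENNReal.HolderConjugate.conjExponent Fact.out).symm
  have : Fact (1 ≤ p.conjExponent) := ⟨ENNReal.HolderConjugate.one_le _ p⟩
  (ContinuousLinearMap.mul ℂ ℂ).lpPairing μ p.conjExponent p
    (ContinuousMap.toLp p.conjExponent μ ℂ (star φ))

theorem conjIntegral_apply (φ : C(X, ℂ)) (f : Lp ℂ p μ) :
    conjIntegral μ φ f = ∫ x, conj (φ x) * f x ∂μ := by
  have : p.conjExponent.HolderConjugate p := (ENNReal.HolderConjugate.conjExponent Fact.out).symm
  have : Fact (1 ≤ p.conjExponent) := ⟨ENNReal.HolderConjugate.one_le _ p⟩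
  refine (ContinuousLinearMap.lpPairing_eq_integral ..).trans (integral_congr_ae ?_)
  filter_upwards [ContinuousMap.coeFn_toLp (p := p.conjExponent) (𝕜 := ℂ) μ (star φ)] with x hx
  rw [hx]
  rfl

theorem conjIntegral_toLp (φ ψ : C(X, ℂ)) :
    conjIntegral μ φ (ContinuousMap.toLp p μ ℂ ψ) = ∫ x, ψ x * conj (φ x) ∂μ := by
  rw [conjIntegral_apply]
  refine integral_congr_ae ?_
  filter_upwards [ContinuousMap.coeFn_toLp (p := p) (𝕜 := ℂ) μ ψ] with x hx
  rw [hx, mul_comm]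

theorem integrable_conj_mul_Lp (φ : C(X, ℂ)) (f : Lp ℂ p μ) :
    Integrable (fun x => conj (φ x) * f x) μ := by
  have hφ : Continuous fun x => conj (φ x) := by fun_prop
  exact ((Lp.memLp f).integrable Fact.out).bdd_mul hφ.aestronglyMeasurable_of_compactSpace
    (.of_forall fun x => (RCLike.norm_conj _).trans_le (φ.norm_coe_le_norm x))

end ConjIntegral

section FourierFunctional

open ComplexConjugate UnitaryIrrep

variable {G ι : Type*} [Group G] [TopologicalSpace G] [CompactSpace G] [MeasurableSpace G]
  [BorelSpace G] {p : ℝ≥0∞} [Fact (1 ≤ p)]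

section Definition

variable (μ : Measure G) [IsFiniteMeasure μ]

/-- The Fourier coefficient `f ↦ d ∫ conj (ξ_{ij}) f dμ` with index `k = (ξ, i, j)`. -/
def fourierFunctional (rep : ι → UnitaryIrrep G) (k : CoeffIndex rep) : Lp ℂ p μ →L[ℂ] ℂ :=
  ((rep k.1).dim : ℂ) • conjIntegral μ (familyCoeff rep k)

theorem fourierFunctional_apply (rep : ι → UnitaryIrrep G) (k : CoeffIndex rep) (f : Lp ℂ p μ) :
    fourierFunctional μ rep k f =
      ∫ x, ((rep k.1).dim : ℂ) * (conj (familyCoeff rep k x) * f x) ∂μ := by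
  rw [integral_const_mul, ← conjIntegral_apply]
  rfl

end Definition

variable [IsTopologicalGroup G] (μ : Measure G) [IsProbabilityMeasure μ] [μ.IsMulLeftInvariant]

theorem UnitaryIrrep.lintegral_enorm_coeff_sq (ξ : UnitaryIrrep G) (i j : Fin ξ.dim) :
    ∫⁻ x, ‖ξ.coeff i j x‖ₑ ^ (2 : ℝ) ∂μ = (ξ.dim : ℝ≥0∞)⁻¹ := by
  have hint : Integrable (fun x => ‖ξ.coeff i j x‖ ^ 2) μ :=
    Continuous.integrable_of_hasCompactSupport (by fun_prop) (HasCompactSupport.of_compactSpace _)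
  have h := ofReal_integral_eq_lintegral_ofReal hint (.of_forall fun x => by positivity)
  rw [integral_norm_coeff_sq, ENNReal.ofReal_inv_of_pos (Nat.cast_pos.2 ξ.dim_pos),
    ENNReal.ofReal_natCast] at h
  simp only [h, ENNReal.ofReal_pow (norm_nonneg _), ofReal_norm, ENNReal.rpow_two]

/-- Hölder's inequality with exponent `p̃ = min 2 p` and Schur orthogonality give
`d⁻¹ ^ (1 - 1 / p̃)`, which the factor `d` turns into `d ^ (1 / p̃)`. -/
theorem UnitaryIrrep.integral_norm_dim_mul_conj_coeff_mul_le (hp : p ≠ ⊤) (ξ : UnitaryIrrep G)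
    (i j : Fin ξ.dim) (f : Lp ℂ p μ) :
    ∫ x, ‖(ξ.dim : ℂ) * (conj (ξ.coeff i j x) * f x)‖ ∂μ ≤
      (ξ.dim : ℝ) ^ (1 / min 2 p.toReal) * ‖f‖ := by
  have hd : (ξ.dim : ℝ≥0∞) ≠ 0 := Nat.cast_ne_zero.2 ξ.dim_pos.ne'
  have hdt : (ξ.dim : ℝ≥0∞) ≠ ⊤ := ENNReal.natCast_ne_top _
  have hdim : ‖(ξ.dim : ℂ)‖ₑ = ξ.dim := by
    rw [← ofReal_norm, Complex.norm_natCast, ENNReal.ofReal_natCast]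
  have hs : (min 2 p).toReal = min 2 p.toReal := by
    rw [ENNReal.toReal_min (by simp) hp, ENNReal.toReal_ofNat]
  have hholder := lintegral_enorm_mul_le_of_norm_le_one (μ := μ) (p := min 2 p)
    (le_min (by norm_num) Fact.out) (min_le_left _ _)
    (ξ.coeff i j).continuous.aestronglyMeasurable_of_compactSpace (Lp.aestronglyMeasurable f)
    (fun x => ξ.norm_mat_apply_le_one x i j)
  rw [lintegral_enorm_coeff_sq, hs] at hholder
  rw [integral_norm_eq_lintegral_enorm ((integrable_conj_mul_Lp μ _ f).const_mul _).1]
  refine ENNReal.toReal_le_of_le_ofReal (by positivity) ?_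
  calc ∫⁻ x, ‖(ξ.dim : ℂ) * (conj (ξ.coeff i j x) * f x)‖ₑ ∂μ
      = ξ.dim * ∫⁻ x, ‖ξ.coeff i j x * f x‖ₑ ∂μ := by
        rw [← lintegral_const_mul' _ _ hdt]
        simp only [enorm_mul, RCLike.enorm_conj, hdim]
    _ ≤ ξ.dim * ((ξ.dim : ℝ≥0∞)⁻¹ ^ (1 - (min 2 p.toReal)⁻¹) * eLpNorm f p μ) := by
        gcongr
        exact hholder.trans (by
          gcongr
          exact eLpNorm_le_eLpNorm_of_exponent_le (min_le_right _ _) (Lp.aestronglyMeasurable f))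
    _ = (ξ.dim : ℝ≥0∞) ^ (1 / min 2 p.toReal) * ‖f‖ₑ := by
        rw [ENNReal.inv_rpow, ← ENNReal.rpow_neg, ← mul_assoc, Lp.enorm_def]
        nth_rewrite 1 [← ENNReal.rpow_one (ξ.dim : ℝ≥0∞)]
        rw [← ENNReal.rpow_add _ _ hd hdt]
        congr 2
        ring
    _ = ENNReal.ofReal ((ξ.dim : ℝ) ^ (1 / min 2 p.toReal) * ‖f‖) := by
        rw [ENNReal.ofReal_mul (by positivity), ← ENNReal.ofReal_rpow_of_pos
          (Nat.cast_pos.2 ξ.dim_pos), ENNReal.ofReal_natCast, ofReal_norm]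

theorem norm_fourierFunctional_le (hp : p ≠ ⊤) (rep : ι → UnitaryIrrep G) (k : CoeffIndex rep) :
    ‖(fourierFunctional μ rep k : Lp ℂ p μ →L[ℂ] ℂ)‖ ≤
      ((rep k.1).dim : ℝ) ^ (1 / min 2 p.toReal) := by
  refine ContinuousLinearMap.opNorm_le_bound _ (by positivity) fun f => ?_
  rw [fourierFunctional_apply]
  exact (norm_integral_le_integral_norm _).trans
    ((rep k.1).integral_norm_dim_mul_conj_coeff_mul_le μ hp _ _ f)

open scoped Classical in
theorem fourierFunctional_toLp_familyCoeff {rep : ι → UnitaryIrrep G}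
    (hrep : Pairwise fun a b => ¬ Equivalent (rep a) (rep b)) (k l : CoeffIndex rep) :
    fourierFunctional μ rep k (ContinuousMap.toLp p μ ℂ (familyCoeff rep l)) =
      if k = l then 1 else 0 := by
  have hd : ((rep k.1).dim : ℂ) ≠ 0 := Nat.cast_ne_zero.2 (rep k.1).dim_pos.ne'
  rw [fourierFunctional, smul_apply, conjIntegral_toLp,
    integral_familyCoeff_mul_conj μ hrep, smul_eq_mul]
  rcases eq_or_ne k l with rfl | hkl
  · rw [if_pos rfl, if_pos rfl, mul_inv_cancel₀ hd]
  · rw [if_neg hkl, if_neg hkl.symm, mul_zero]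

end FourierFunctional

section SystemOfRepresentatives

open UnitaryIrrep

variable {G : Type*} [Group G] [TopologicalSpace G] {rep : UnitaryDual G → UnitaryIrrep G}

theorem pairwise_not_equivalent_of_cls_eq (hrep : ∀ c, (rep c).cls = c) :
    Pairwise fun a b => ¬ Equivalent (rep a) (rep b) := by
  intro a b hab h
  exact hab ((hrep a).symm.trans ((Quotient.sound h : (rep a).cls = (rep b).cls).trans (hrep b)))

theorem coeff_mem_span_of_equivalent {ξ η : UnitaryIrrep G} (h : Equivalent ξ η)
    (k l : Fin η.dim) :
    η.coeff k l ∈ Submodule.span ℂ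
      (Set.range fun ij : Fin ξ.dim × Fin ξ.dim => ξ.coeff ij.1 ij.2) := by
  obtain ⟨U, -, hUU, hU⟩ := h
  have hη (x : G) : η.mat x = U * ξ.mat x * Uᴴ := by
    rw [hU, Matrix.mul_assoc, hUU, Matrix.mul_one]
  have hsum : η.coeff k l = ∑ j, ∑ i, (U k i * Uᴴ j l) • ξ.coeff i j := by
    ext x
    simp only [coeff_apply, hη, Matrix.mul_apply, ContinuousMap.coe_sum, ContinuousMap.coe_smul,
      Finset.sum_apply, Pi.smul_apply, smul_eq_mul, Finset.sum_mul, mul_right_comm]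
  rw [hsum]
  exact Submodule.sum_mem _ fun j _ => Submodule.sum_mem _ fun i _ => Submodule.smul_mem _ _
    (Submodule.subset_span ⟨(i, j), rfl⟩)

theorem coeffSpan_le_span_familyCoeff (hrep : ∀ c, (rep c).cls = c) :
    coeffSpan G ≤ Submodule.span ℂ (Set.range (familyCoeff rep)) := by
  refine Submodule.span_le.2 ?_
  rintro _ ⟨η, k, l, rfl⟩
  have hη : Equivalent (rep η.cls) η := Quotient.exact (hrep η.cls)
  refine Submodule.span_mono ?_ (coeff_mem_span_of_equivalent hη k l)
  rintro _ ⟨ij, rfl⟩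
  exact ⟨⟨η.cls, ij⟩, rfl⟩

theorem isMulRightInvariant_of_isHaarMeasure [IsTopologicalGroup G] [CompactSpace G]
    [MeasurableSpace G] [BorelSpace G] (μ : Measure G) [μ.IsHaarMeasure] [IsProbabilityMeasure μ] :
    μ.IsMulRightInvariant := by
  refine ⟨fun g => ?_⟩
  have : IsProbabilityMeasure (μ.map (· * g)) :=
    Measure.isProbabilityMeasure_map (continuous_mul_const g).aemeasurable
  exact Measure.isHaarMeasure_eq_of_isProbabilityMeasure (μ.map (· * g)) μ

theorem eq_of_eqOn_familyCoeff [IsTopologicalGroup G] [CompactSpace G] [MeasurableSpace G]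
    [BorelSpace G] (μ : Measure G) [μ.IsHaarMeasure] [IsProbabilityMeasure μ] {p : ℝ≥0∞}
    [Fact (1 ≤ p)] (hp : p ≠ ⊤) (hrep : ∀ c, (rep c).cls = c) {F : Type*}
    [NormedAddCommGroup F] [NormedSpace ℂ F] {A B : Lp ℂ p μ →L[ℂ] F}
    (hAB : ∀ k, A (ContinuousMap.toLp p μ ℂ (familyCoeff rep k)) =
      B (ContinuousMap.toLp p μ ℂ (familyCoeff rep k))) : A = B := by
  have := isMulRightInvariant_of_isHaarMeasure μ
  have hspan : Set.EqOn (A ∘L ContinuousMap.toLp p μ ℂ) (B ∘L ContinuousMap.toLp p μ ℂ)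
      (Submodule.span ℂ (Set.range (familyCoeff rep))) :=
    LinearMap.eqOn_span (by rintro _ ⟨k, rfl⟩; exact hAB k)
  refine DFunLike.coe_injective
    (A.continuous.ext_on (dense_toLp_image_coeffSpan μ hp) B.continuous ?_)
  rintro _ ⟨g, hg, rfl⟩
  exact hspan (coeffSpan_le_span_familyCoeff hrep hg)

theorem hasSum_fourierFunctional_smul [IsTopologicalGroup G] [CompactSpace G] [MeasurableSpace G]
    [BorelSpace G] (μ : Measure G) [μ.IsHaarMeasure] [IsProbabilityMeasure μ]
    {p : ℝ≥0∞} [Fact (1 ≤ p)] (hp : p ≠ ⊤) (hrep : ∀ c, (rep c).cls = c)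
    {F : Type*} [NormedAddCommGroup F] [NormedSpace ℂ F] [CompleteSpace F] (A : Lp ℂ p μ →L[ℂ] F)
    (hA : Summable fun k : CoeffIndex rep => ((rep k.1).dim : ℝ) ^ (1 / min 2 p.toReal) *
      ‖A (ContinuousMap.toLp p μ ℂ (familyCoeff rep k))‖) (f : Lp ℂ p μ) :
    HasSum (fun k => fourierFunctional μ rep k f •
      A (ContinuousMap.toLp p μ ℂ (familyCoeff rep k))) (A f) := by
  classical
  let Q (k : CoeffIndex rep) : Lp ℂ p μ →L[ℂ] F := (fourierFunctional μ rep k).smulRight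
    (A (ContinuousMap.toLp p μ ℂ (familyCoeff rep k)))
  have hQ : Summable Q := hA.of_norm_bounded fun k => by
    rw [ContinuousLinearMap.norm_smulRight_apply]
    gcongr
    exact norm_fourierFunctional_le μ hp rep k
  have hQf (f : Lp ℂ p μ) : HasSum (fun k => Q k f) ((∑' k, Q k) f) :=
    hQ.hasSum.mapL (ContinuousLinearMap.apply ℂ F f)
  have hQA : ∑' k, Q k = A := by
    refine eq_of_eqOn_familyCoeff μ hp hrep fun l => (hQf _).unique ?_
    convert hasSum_ite_eq l (A (ContinuousMap.toLp p μ ℂ (familyCoeff rep l))) using 2 with k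
    rw [ContinuousLinearMap.smulRight_apply, fourierFunctional_toLp_familyCoeff μ
      (pairwise_not_equivalent_of_cls_eq hrep), ite_smul, one_smul, zero_smul]
    split_ifs with h
    · rw [h]
    · rfl
  have hAf := hQf f
  rwa [hQA] at hAf

end SystemOfRepresentatives

section Symbol

open ComplexConjugate UnitaryIrrep

theorem sum_norm_le_opNormLinfty {d : ℕ} (B : Matrix (Fin d) (Fin d) ℂ) (i : Fin d) :
    ∑ j, ‖B i j‖ ≤ opNormLinfty B :=
  le_ciSup (f := fun i => ∑ j, ‖B i j‖) (Set.finite_range _).bddAbove i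

theorem tsum_coeffIndex {G ι : Type*} [Group G] [TopologicalSpace G] (rep : ι → UnitaryIrrep G)
    (F : ι → ℝ≥0∞) :
    ∑' k : CoeffIndex rep, F k.1 = ∑' a, ((rep a).dim : ℝ≥0∞) ^ (2 : ℝ) * F a := by
  rw [ENNReal.tsum_sigma']
  simp [sq]

variable {G : Type*} [Group G] [TopologicalSpace G] [CompactSpace G] [MeasurableSpace G]
  [BorelSpace G] {μ : Measure G} {p : ℝ≥0∞} [Fact (1 ≤ p)]

section FiniteMeasure

variable [IsFiniteMeasure μ] (A : Lp ℂ p μ →L[ℂ] Lp ℂ p μ)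

theorem mat_mul_matrixSymbol (ξ : UnitaryIrrep G) (x : G) :
    ξ.mat x * matrixSymbol A ξ x =
      Matrix.of fun i j => (A (ContinuousMap.toLp p μ ℂ (ξ.coeff i j)) : G → ℂ) x := by
  rw [matrixSymbol, ← Matrix.mul_assoc, mul_eq_one_comm.1 (ξ.conjTranspose_mat_mul_mat x),
    Matrix.one_mul]

theorem enorm_apply_coeff_le (ξ : UnitaryIrrep G) (i j : Fin ξ.dim) :
    ‖A (ContinuousMap.toLp p μ ℂ (ξ.coeff i j))‖ₑ ≤
      eLpNorm (fun x => opNormLinfty (matrixSymbol A ξ x)ᵀ) p μ := by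
  rw [Lp.enorm_def]
  refine eLpNorm_mono_real fun x => ?_
  have hsymbol := congrFun (congrFun (mat_mul_matrixSymbol A ξ x) i) j
  rw [Matrix.of_apply, Matrix.mul_apply] at hsymbol
  rw [← hsymbol]
  calc ‖∑ k, ξ.mat x i k * matrixSymbol A ξ x k j‖
      ≤ ∑ k, ‖(matrixSymbol A ξ x)ᵀ j k‖ := norm_sum_le_of_le _ fun k _ =>
        (norm_mul _ _).trans_le
          (mul_le_of_le_one_left (norm_nonneg _) (ξ.norm_mat_apply_le_one x i k))
    _ ≤ opNormLinfty (matrixSymbol A ξ x)ᵀ := sum_norm_le_opNormLinfty _ _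

theorem summable_rpow_of_tsum_symbol_lt_top {ι : Type*} (rep : ι → UnitaryIrrep G) {r s : ℝ}
    (hr0 : 0 < r)
    (hA : ∑' a, ((rep a).dim : ℝ≥0∞) ^ (2 + r / s) *
      eLpNorm (fun x => opNormLinfty (matrixSymbol A (rep a) x)ᵀ) p μ ^ r < ⊤) :
    Summable fun k : CoeffIndex rep => (((rep k.1).dim : ℝ) ^ (1 / s) *
      ‖A (ContinuousMap.toLp p μ ℂ (familyCoeff rep k))‖) ^ r := by
  let F (a : ι) : ℝ≥0∞ := ((rep a).dim : ℝ≥0∞) ^ (r / s) *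
    eLpNorm (fun x => opNormLinfty (matrixSymbol A (rep a) x)ᵀ) p μ ^ r
  have hF : ∑' k : CoeffIndex rep, F k.1 < ⊤ := by
    rw [tsum_coeffIndex]
    convert hA using 3 with a
    rw [← mul_assoc, ENNReal.rpow_add _ _ (Nat.cast_ne_zero.2 (rep a).dim_pos.ne')
      (ENNReal.natCast_ne_top _)]
  have hle (k : CoeffIndex rep) : ENNReal.ofReal ((((rep k.1).dim : ℝ) ^ (1 / s) *
      ‖A (ContinuousMap.toLp p μ ℂ (familyCoeff rep k))‖) ^ r) ≤ F k.1 := by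
    rw [← ENNReal.ofReal_rpow_of_nonneg (by positivity) hr0.le, ENNReal.ofReal_mul (by positivity),
      ENNReal.mul_rpow_of_nonneg _ _ hr0.le, ← ENNReal.ofReal_rpow_of_pos
      (Nat.cast_pos.2 (rep k.1).dim_pos), ENNReal.ofReal_natCast, ← ENNReal.rpow_mul, ofReal_norm,
      one_div_mul_eq_div]
    simp only [F]
    gcongr
    exact enorm_apply_coeff_le A _ _ _
  refine (ENNReal.summable_toReal
    (ne_top_of_le_ne_top hF.ne (ENNReal.tsum_le_tsum hle))).congr fun k => ?_
  rw [ENNReal.toReal_ofReal (by positivity)]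

theorem hasSum_dim_mul_trace_matrixSymbol {ι : Type*} (rep : ι → UnitaryIrrep G) {x : G}
    (h : Summable fun k : CoeffIndex rep => ((rep k.1).dim : ℂ) * (conj (familyCoeff rep k x) *
      (A (ContinuousMap.toLp p μ ℂ (familyCoeff rep k)) : G → ℂ) x)) :
    HasSum (fun a => ((rep a).dim : ℂ) * (matrixSymbol A (rep a) x).trace)
      (∑' k : CoeffIndex rep, ((rep k.1).dim : ℂ) * (conj (familyCoeff rep k x) *
        (A (ContinuousMap.toLp p μ ℂ (familyCoeff rep k)) : G → ℂ) x)) := by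
  refine h.hasSum.sigma fun a => ?_
  have htrace : (matrixSymbol A (rep a) x).trace = ∑ ij, conj (familyCoeff rep ⟨a, ij⟩ x) *
      (A (ContinuousMap.toLp p μ ℂ (familyCoeff rep ⟨a, ij⟩)) : G → ℂ) x := by
    rw [Fintype.sum_prod_type_right]
    rfl
  rw [htrace, Finset.mul_sum]
  exact hasSum_fintype _

end FiniteMeasure

variable [IsTopologicalGroup G] [IsProbabilityMeasure μ] [μ.IsMulLeftInvariant]

theorem summable_trace_and_tsum_fourierFunctional_eq {ι : Type*} [Countable ι] (hp : p ≠ ⊤)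
    (A : Lp ℂ p μ →L[ℂ] Lp ℂ p μ) (rep : ι → UnitaryIrrep G)
    (h : Summable fun k : CoeffIndex rep => ((rep k.1).dim : ℝ) ^ (1 / min 2 p.toReal) *
      ‖A (ContinuousMap.toLp p μ ℂ (familyCoeff rep k))‖) :
    (∀ᵐ x ∂μ, Summable fun a => ((rep a).dim : ℂ) * (matrixSymbol A (rep a) x).trace) ∧
      Integrable (fun x => ∑' a, ((rep a).dim : ℂ) * (matrixSymbol A (rep a) x).trace) μ ∧
      ∑' k, fourierFunctional μ rep k (A (ContinuousMap.toLp p μ ℂ (familyCoeff rep k))) =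
        ∫ x, ∑' a, ((rep a).dim : ℂ) * (matrixSymbol A (rep a) x).trace ∂μ := by
  let g (k : CoeffIndex rep) (x : G) : ℂ := ((rep k.1).dim : ℂ) *
    (conj (familyCoeff rep k x) * (A (ContinuousMap.toLp p μ ℂ (familyCoeff rep k)) : G → ℂ) x)
  have hg (k) : Integrable (g k) μ := (integrable_conj_mul_Lp μ _ _).const_mul _
  have hgs : Summable fun k => ∫ x, ‖g k x‖ ∂μ :=
    h.of_nonneg_of_le (fun k => integral_nonneg fun x => norm_nonneg _)
      fun k => (rep k.1).integral_norm_dim_mul_conj_coeff_mul_le μ hp _ _ _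
  have hsum : ∀ᵐ x ∂μ, HasSum (fun a => ((rep a).dim : ℂ) * (matrixSymbol A (rep a) x).trace)
      (∑' k, g k x) := by
    filter_upwards [ae_summable_of_summable_integral_norm hg hgs] with x hx
    exact hasSum_dim_mul_trace_matrixSymbol A rep hx
  have htsum : (fun x => ∑' k, g k x) =ᵐ[μ]
      fun x => ∑' a, ((rep a).dim : ℂ) * (matrixSymbol A (rep a) x).trace := by
    filter_upwards [hsum] with x hx using hx.tsum_eq.symm
  refine ⟨hsum.mono fun x hx => hx.summable,
    (integrable_tsum_of_summable_integral_norm hg hgs).congr htsum, ?_⟩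
  rw [← integral_congr_ae htsum, ← (hasSum_integral_of_summable_integral_norm hg hgs).tsum_eq]
  simp only [fourierFunctional_apply, g]

end Symbol

theorem mainTheorem2_general {G : Type*} [Group G] [TopologicalSpace G] [IsTopologicalGroup G]
    [CompactSpace G] [SecondCountableTopology G] [MeasurableSpace G] [BorelSpace G]
    (μ : Measure G) [μ.IsHaarMeasure] [IsProbabilityMeasure μ]
    {r : ℝ} (hr0 : 0 < r) (hr1 : r ≤ 1) {p : ℝ≥0∞} [Fact (1 ≤ p)] (hp : p ≠ ⊤)
    {rep : UnitaryDual G → UnitaryIrrep G} (hrep : ∀ c, (rep c).cls = c)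
    (A : Lp ℂ p μ →L[ℂ] Lp ℂ p μ)
    (hA : ∑' c : UnitaryDual G,
        ((rep c).dim : ℝ≥0∞) ^ (2 + r / min 2 p.toReal) *
          eLpNorm (fun x => opNormLinfty (matrixSymbol A (rep c) x)ᵀ) p μ ^ r < ⊤) :
    IsRNuclear r A ∧
      (∀ᵐ x ∂μ, Summable fun c : UnitaryDual G =>
        ((rep c).dim : ℂ) * (matrixSymbol A (rep c) x).trace) ∧
      Integrable (fun x => ∑' c : UnitaryDual G,
        ((rep c).dim : ℂ) * (matrixSymbol A (rep c) x).trace) μ ∧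
      HasNuclearTrace A (∫ x, ∑' c : UnitaryDual G,
        ((rep c).dim : ℂ) * (matrixSymbol A (rep c) x).trace ∂μ) := by
  have : Countable (UnitaryDual G) := UnitaryIrrep.countable_of_pairwise_not_equivalent μ
    (pairwise_not_equivalent_of_cls_eq hrep)
  have hweight := summable_rpow_of_tsum_symbol_lt_top A rep hr0 hA
  have hsummable := summable_of_summable_rpow (fun k => by positivity) hr0 hr1 hweight
  have hnuclear : Summable fun k => ‖(fourierFunctional μ rep k : Lp ℂ p μ →L[ℂ] ℂ)‖ ^ r *
      ‖A (ContinuousMap.toLp p μ ℂ (UnitaryIrrep.familyCoeff rep k))‖ ^ r := by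
    refine hweight.of_nonneg_of_le (fun k => by positivity) fun k => ?_
    rw [← Real.mul_rpow (norm_nonneg _) (norm_nonneg _)]
    gcongr
    exact norm_fourierFunctional_le μ hp rep k
  obtain ⟨x', y, hxy, htr⟩ := exists_isNuclearRepresentation_of_countable hr0
    (hasSum_fourierFunctional_smul μ hp hrep A hsummable) hnuclear
  obtain ⟨hsum, hint, htrace⟩ := summable_trace_and_tsum_fourierFunctional_eq hp A rep hsummable
  refine ⟨⟨x', y, hxy⟩, hsum, hint, ?_⟩
  rw [← htrace, ← htr]
  exact (hxy.one_of_le_one hr0 hr1).hasNuclearTrace (hasBoundedApproximationProperty_Lp hp)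

end

theorem mainTheorem2
    {n : ℕ} {G : Type*} [TopologicalSpace G] [ChartedSpace (EuclideanSpace ℝ (Fin n)) G]
    [Group G] [LieGroup (𝓡 n) ∞ G] [CompactSpace G] [T2Space G]
    [MeasurableSpace G] [BorelSpace G]
    (μ : Measure G) [μ.IsHaarMeasure] [IsProbabilityMeasure μ]
    (r : ℝ) (hr0 : 0 < r) (hr1 : r ≤ 1)
    (p : ℝ≥0∞) [Fact (1 ≤ p)] (hp : p ≠ ⊤)
    (rep : UnitaryDual G → UnitaryIrrep G) (hrep : ∀ c, (rep c).cls = c)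
    (A : Lp ℂ p μ →L[ℂ] Lp ℂ p μ)
    (hA : ∑' c : UnitaryDual G,
        ((rep c).dim : ℝ≥0∞) ^ (2 + r / min 2 p.toReal) *
          eLpNorm (fun x => opNormLinfty (matrixSymbol A (rep c) x)ᵀ) p μ ^ r < ⊤) :
    IsRNuclear r A ∧
      (∀ᵐ x ∂μ, Summable fun c : UnitaryDual G =>
        ((rep c).dim : ℂ) * (matrixSymbol A (rep c) x).trace) ∧
      Integrable (fun x => ∑' c : UnitaryDual G,
        ((rep c).dim : ℂ) * (matrixSymbol A (rep c) x).trace) μ ∧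
      HasNuclearTrace A (∫ x, ∑' c : UnitaryDual G,
        ((rep c).dim : ℂ) * (matrixSymbol A (rep c) x).trace ∂μ) := by
  have : IsTopologicalGroup G := topologicalGroup_of_lieGroup (𝓡 n) ∞
  have : SecondCountableTopology G :=
    ChartedSpace.secondCountable_of_sigmaCompact (EuclideanSpace ℝ (Fin n)) G
  exact mainTheorem2_general μ hr0 hr1 hp hrep A hA
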